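/- Let $N\ge 2$ and $\Gamma\in\mathbb R\setminus\{0\}$, and consider $N+1$ planar point vortices $z=(z_0,\dots,z_N)$ with strengths $\Gamma_0=\Gamma$ and $\Gamma_n=-\Gamma/N$ for $n\ge 1$ (for $N=3$: four vortices with strengths $\Gamma,-\Gamma/3,-\Gamma/3,-\Gamma/3$). The phase space is $P=\{z\in\mathbb C^{N+1}: z_m\ne z_n \text{ for } m\ne n\}$, with bracket $\{f,g\}=\sum_n\frac1{\Gamma_n}\big(\frac{\partial f}{\partial x_n}\frac{\partial g}{\partial y_n}-\frac{\partial f}{\partial y_n}\frac{\partial g}{\partial x_n}\big)$, where $z_n=x_n+iy_n$, and Hamiltonian $H=-\frac1{8\pi}\sum_{m\ne n}\Gamma_m\Gamma_n\ln|z_m-z_n|^2$. The group $SE(2)=\{(A,a):A,a\in\mathbb C,\ |A|=1\}$ acts diagonally by $(A,a)z=Az+a$; $SO(2)$ is its subgroup $\{(A,0)\}$. Put $\nu=-i\sum_n\Gamma_nz_n$, $P^{\rm sing}=\{z\in P:\nu=0\}$, $P^\circ=P\setminus P^{\rm sing}$. Let $$P_1=\Big\{u=(u_0,u_1,\dots,u_N):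 u_0\in\mathbb R,\ u_0\ge0,\ u_1,\dots,u_N\in\mathbb C,\ \sum_{n\ge1}u_n=0,\ u_m\ne u_n\ (m\ne n;\ m,n\ge1),\ u_n+\tfrac{u_0}N\ne0\ (n\ge1)\Big\},$$ $P_1^{\rm sing}=\{u\in P_1:u_0=0\}$ and $P_1^\circ=P_1\setminus P_1^{\rm sing}$. Let $\pi:P^\circ\to P_1^\circ$ and $\iota:P_1\to P$ be $$\pi:\ u_0=\Big|\sum_{m\ge1}(z_m-z_0)\Big|,\quad u_n=u_0(z_n-z_0)\Big(\sum_{m\ge1}(z_m-z_0)\Big)^{-1}-\frac{u_0}N;\qquad \iota:\ z_0=0,\quad z_n=u_n+\frac{u_0}N .$$ Give $P_1$ the Hamiltonian $H\circ\iota$ and the bracket $\{f,g\}=-\frac N\Gamma\sum_{n\ge1}\big(\frac{\partial f}{\partial x_n}\frac{\partial g}{\partial y_n}-\frac{\partial f}{\partial y_n}\frac{\partial g}{\partial x_n}\big)$, $u_n=x_n+iy_n$, where $u_0$ is a parameter and $f,g$ are extended from $\sum_{n\ge1}u_n=0$ to be invariant under $(u_1,\dots,u_N)\mapsto(u_1+c,\dots,u_N+c)$,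 $c\in\mathbb C$. $SO(2)$ acts on $P_1^{\rm sing}$ by $A(0,u_1,\dots,u_N)=(0,Au_1,\dots,Au_N)$. Then: (a) $P$ is the disjoint union of the $SE(2)$-invariant submanifolds $P^\circ$ (open and dense) and $P^{\rm sing}$ (the intersection of $P$ with the real codimension 2 linear subspace $\nu=0$), and $P_1$ is the disjoint union of $P_1^\circ$ and $P_1^{\rm sing}$. $P^\circ$ is a Poisson submanifold of $P$. $P^{\rm sing}$ is Poisson with respect to $SE(2)$-invariant functions: on any $SE(2)$-invariant open subset $U$ of $P$ the bracket of two $SE(2)$-invariant smooth functions is smooth and $SE(2)$-invariant; if $f,g$ are smooth on $U$, $f$ is $SE(2)$-invariant and $g=0$ on $U\cap P^{\rm sing}$, then $\{f,g\}=0$ on $U\cap P^{\rm sing}$; and every $SE(2)$-invariant smooth function on $P^{\rm sing}$ extends to an $SE(2)$-invariant smooth function on an $SE(2)$-invariant open neighbourhood of $P^{\rm sing}$ in $P$. (b) $\pi$ is a Poisson quotient for the action of $SE(2)$ on $P^\circ$: it is a smooth surjective Poisson submersion $P^\circ\to P_1^\circ$, and $\pi(z)=\pi(z')$ if and only if $(A,a)z=z'$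 for some $(A,a)\in SE(2)$. Moreover $H\circ\iota\circ\pi=H$ on $P^\circ$, and both $H\circ\iota$ and the bracket of any two smooth functions on $P_1$ are smooth on all of $P_1$, including the boundary $P_1^{\rm sing}$. (c) $\iota:P_1\to P$ is an injective immersion with $\iota(P_1^\circ)\subseteq P^\circ$ and $\iota(P_1^{\rm sing})\subseteq P^{\rm sing}$; the stabilizer in $SE(2)$ of the set $\iota(P_1^{\rm sing})$ is $SO(2)$; $\iota$ is $SO(2)$-intertwining on $P_1^{\rm sing}$; and $\iota$ induces a diffeomorphism $P_1^{\rm sing}/SO(2)\cong P^{\rm sing}/SE(2)$ of quotient manifolds. (d) Let $I\subseteq\mathbb R$ be an open interval. For every integral curve $c(t)\in P_1^{\rm sing}$, $t\in I$, of the Hamiltonian system on $P_1$ there is a smooth curve $g(t)\in SE(2)$ such that $g(t)\,\iota(c(t))$ is an integral curve in $P^{\rm sing}$ of the vortex system. Conversely, for every integral curve $d(t)\in P^{\rm sing}$, $t\in I$, of the vortex system there are an integral curve $c(t)\in P_1^{\rm sing}$ of the system on $P_1$ and a smooth curve $g(t)\in SE(2)$ such that $d(t)=g(t)\,\iota(c(t))$.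 -/

import Mathlib

open scoped Manifold ContDiff Pointwise

noncomputable section

namespace VortexResolution

/-! ### The planar Euclidean group -/

/-- The planar Euclidean group `SE(2)` of pairs `(A, a)`, `A ∈ ℂ`, `|A| = 1`, `a ∈ ℂ`. -/
@[ext] structure SE2 where
  rot : Circle
  trans : ℂ

namespace SE2

instance : Mul SE2 := ⟨fun g h => ⟨g.rot * h.rot, g.trans + g.rot * h.trans⟩⟩
instance : One SE2 := ⟨⟨1, 0⟩⟩
instance : Inv SE2 := ⟨fun g => ⟨g.rot⁻¹, -((g.rot⁻¹ : Circle) * g.trans)⟩⟩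

@[simp] theorem mul_rot (g h : SE2) : (g * h).rot = g.rot * h.rot := rfl
@[simp] theorem mul_trans (g h : SE2) : (g * h).trans = g.trans + g.rot * h.trans := rfl
@[simp] theorem one_rot : (1 : SE2).rot = 1 := rfl
@[simp] theorem one_trans : (1 : SE2).trans = 0 := rfl
@[simp] theorem inv_rot (g : SE2) : (g⁻¹).rot = g.rot⁻¹ := rfl
@[simp] theorem inv_trans (g : SE2) :
    (g⁻¹).trans = -((g.rot⁻¹ : Circle) * g.trans) := rfl

instance : Group SE2 :=
  Group.ofLeftAxioms
    (fun f g h => by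
      ext
      · simp [mul_assoc]
      · simp [mul_add, mul_assoc, add_assoc])
    (fun g => by ext <;> simp)
    (fun g => by ext <;> simp)

/-- The standard action `(A, a) z = A z + a` on the plane. On configurations `Fin k → ℂ` the group
acts diagonally (through the product action). -/
instance : MulAction SE2 ℂ where
  smul g z := g.rot * z + g.trans
  one_smul z := by
    change ((1 : SE2).rot : ℂ) * z + (1 : SE2).trans = z
    simp
  mul_smul g h z := by
    change ((g * h).rot : ℂ) * z + (g * h).trans = g.rot * (h.rot * z + h.trans) + g.trans
    simp only [mul_rot, mul_trans, Circle.coe_mul]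
    ring

theorem smul_def (g : SE2) (z : ℂ) : g • z = g.rot * z + g.trans := rfl

/-- The inclusion `A ↦ (A, 0)` of `SO(2) = {A ∈ ℂ : |A| = 1}` into `SE(2)`. -/
def ofCircle : Circle →* SE2 where
  toFun A := ⟨A, 0⟩
  map_one' := rfl
  map_mul' A B := by ext <;> simp

end SE2

/-- The natural copy of `SO(2)` in `SE(2)`. -/
def SO2 : Subgroup SE2 := SE2.ofCircle.range

/-! ### Vortex systems in general -/

/-- The vortex Poisson bracket with strengths `Γ n`,
`{f, g} = ∑ n, (1 / Γ n) (∂f/∂xₙ ∂g/∂yₙ - ∂f/∂yₙ ∂g/∂xₙ)`, where `zₙ = xₙ + i yₙ`. -/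
def vortexBracket {k : ℕ} (Γ : Fin k → ℝ) (f g : (Fin k → ℂ) → ℝ) (z : Fin k → ℂ) : ℝ :=
  ∑ n, (1 / Γ n) *
    (fderiv ℝ f z (Pi.single n 1) * fderiv ℝ g z (Pi.single n Complex.I)
      - fderiv ℝ f z (Pi.single n Complex.I) * fderiv ℝ g z (Pi.single n 1))

/-- The vortex Hamiltonian `-(1 / 8π) ∑_{m ≠ n} Γ m Γ n ln |z_m - z_n|²`. -/
def vortexHamiltonian {k : ℕ} (Γ : Fin k → ℝ) (z : Fin k → ℂ) : ℝ :=
  -(1 / (8 * Real.pi)) *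
    ∑ m, ∑ n, if m ≠ n then Γ m * Γ n * Real.log (‖z m - z n‖ ^ 2) else 0

/-- `c` is, on the time interval `I`, an integral curve in the space `S` of the Hamiltonian system
with bracket `br` and Hamiltonian `H`: it has values in `S`, and `d/dt f(c(t)) = {f, H}(c(t))` for
all smooth functions `f` on `S`. -/
def IsIntegralCurveOfHamiltonian {E : Type*} [NormedAddCommGroup E] [NormedSpace ℝ E] (S : Set E)
    (br : (E → ℝ) → (E → ℝ) → E → ℝ) (H : E → ℝ) (I : Set ℝ) (c : ℝ → E) : Prop :=
  ∀ t ∈ I, c t ∈ S ∧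
    ∀ f : E → ℝ, ContDiffOn ℝ ∞ f S → HasDerivAt (fun s => f (c s)) (br f H (c t)) t

/-- The curve `g(t) = (A(t), a(t))` in `SE(2)`, a submanifold of `ℂ²`, is smooth on `I`. -/
def SmoothCurve (I : Set ℝ) (g : ℝ → SE2) : Prop :=
  ContDiffOn ℝ ∞ (fun t => (((g t).rot : ℂ), (g t).trans)) I

/-! ### One central vortex of strength `Γ` and `N` vortices of strength `-Γ / N` -/

/-- The strengths `Γ₀ = Γ` and `Γₙ = -Γ / N` for `n = 1, …, N`. -/
def strength (N : ℕ) (Γ : ℝ) : Fin (N + 1) → ℝ := Fin.cons Γ (fun _ => -Γ / N)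

/-- The translational momentum `ν = -i ∑ n, Γₙ zₙ`. -/
def nu (N : ℕ) (Γ : ℝ) : (Fin (N + 1) → ℂ) →ₗ[ℝ] ℂ :=
  ∑ n, (-Complex.I * (strength N Γ n : ℂ)) • (LinearMap.proj n : (Fin (N + 1) → ℂ) →ₗ[ℝ] ℂ)

/-- The phase space `P`: the positions `z₀, …, z_N` are pairwise distinct. -/
def P (N : ℕ) : Set (Fin (N + 1) → ℂ) := {z | Function.Injective z}

/-- The rotational sector `P^sing`. -/
def Psing (N : ℕ) (Γ : ℝ) : Set (Fin (N + 1) → ℂ) := {z ∈ P N | nu N Γ z = 0}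

/-- The regular sector `P°`. -/
def Preg (N : ℕ) (Γ : ℝ) : Set (Fin (N + 1) → ℂ) := P N \ Psing N Γ

/-- The bracket of the vortex system. -/
def bracketP (N : ℕ) (Γ : ℝ) :
    ((Fin (N + 1) → ℂ) → ℝ) → ((Fin (N + 1) → ℂ) → ℝ) → (Fin (N + 1) → ℂ) → ℝ :=
  vortexBracket (strength N Γ)

/-- The Hamiltonian of the vortex system. -/
def HP (N : ℕ) (Γ : ℝ) : (Fin (N + 1) → ℂ) → ℝ := vortexHamiltonian (strength N Γ)

/-! ### The unified phase space `P₁` -/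

/-- The space of `(u₁, …, u_N) ∈ ℂ^N` with `∑ uₙ = 0`. -/
def W (N : ℕ) : Submodule ℂ (Fin N → ℂ) :=
  LinearMap.ker (∑ n, (LinearMap.proj n : (Fin N → ℂ) →ₗ[ℂ] ℂ))

theorem mem_W {N : ℕ} {w : Fin N → ℂ} : w ∈ W N ↔ ∑ n, w n = 0 := by
  simp [W, LinearMap.sum_apply]

/-- The projection `ℂ^N → W` along `(1, …, 1)`, which subtracts the mean. -/
def projW (N : ℕ) (w : Fin N → ℂ) : W N :=
  ⟨fun n => w n - (∑ m, w m) / N, by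
    rw [mem_W, Finset.sum_sub_distrib]
    rcases Nat.eq_zero_or_pos N with rfl | hN
    · simp
    · have : (N : ℂ) ≠ 0 := by exact_mod_cast hN.ne'
      simp [mul_div_cancel₀ _ this]⟩

/-- The phase space `P₁` of all `(u₀, u₁, …, u_N)` with `u₀ ≥ 0` and `∑_{n ≥ 1} uₙ = 0` for which
the points `0, u₁ + u₀ / N, …, u_N + u₀ / N` are pairwise distinct. It is a manifold with boundary,
relatively open in the closed half space `u₀ ≥ 0` of the vector space `ℝ × W`. -/
def P1 (N : ℕ) : Set (ℝ × W N) :=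
  {u | 0 ≤ u.1 ∧ Function.Injective (u.2 : Fin N → ℂ) ∧
    ∀ n, (u.2 : Fin N → ℂ) n + (u.1 : ℂ) / N ≠ 0}

/-- The boundary `P₁^sing`. -/
def P1sing (N : ℕ) : Set (ℝ × W N) := {u ∈ P1 N | u.1 = 0}

/-- The interior `P₁°`. -/
def P1reg (N : ℕ) : Set (ℝ × W N) := P1 N \ P1sing N

/-- The map `π`: `u₀ = |∑ₘ (zₘ - z₀)|` and `uₙ = u₀ (zₙ - z₀) (∑ₘ (zₘ - z₀))⁻¹ - u₀ / N`. -/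
def proj (N : ℕ) (z : Fin (N + 1) → ℂ) : ℝ × W N :=
  let s : ℂ := ∑ m : Fin N, (z m.succ - z 0)
  (‖s‖, ⟨fun n => (‖s‖ : ℂ) * (z n.succ - z 0) * s⁻¹ - (‖s‖ : ℂ) / N, by
    rw [mem_W, Finset.sum_sub_distrib, ← Finset.sum_mul, ← Finset.mul_sum]
    change (‖s‖ : ℂ) * s * s⁻¹ - _ = 0
    rcases Nat.eq_zero_or_pos N with rfl | hN
    · simp [s]
    · have hN' : (N : ℂ) ≠ 0 := by exact_mod_cast hN.ne'
      by_cases hs : s = 0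
      · simp [hs]
      · simp [hs, mul_div_cancel₀ _ hN']⟩)

/-- The standard gauge `ι`: `z₀ = 0` and `zₙ = uₙ + u₀ / N`. -/
def sect (N : ℕ) (u : ℝ × W N) : Fin (N + 1) → ℂ :=
  Fin.cons 0 (fun n => (u.2 : Fin N → ℂ) n + (u.1 : ℂ) / N)

/-- The bracket on `P₁`: `u₀` is a parameter, and on `∑ uₙ = 0` it is the bracket of the system of
`N` vortices of strengths `-Γ / N`, applied to functions that have been extended to `ℂ^N` so as to
be invariant under the diagonal addition `(u₁, …, u_N) ↦ (u₁ + a, …, u_N + a)`. -/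
def bracketP1 (N : ℕ) (Γ : ℝ) (f g : ℝ × W N → ℝ) (u : ℝ × W N) : ℝ :=
  vortexBracket (fun _ : Fin N => -Γ / N)
    (fun w => f (u.1, projW N w)) (fun w => g (u.1, projW N w)) (u.2 : Fin N → ℂ)

/-- The Hamiltonian on `P₁`: the vortex Hamiltonian in the standard gauge. -/
def HP1 (N : ℕ) (Γ : ℝ) (u : ℝ × W N) : ℝ := HP N Γ (sect N u)

/-! ### The singular sectors as manifolds, and their orbit spaces -/

/-- `P^sing` as a manifold: an open subset of the linear subspace `ν = 0`. -/
def PsingM (N : ℕ) (Γ : ℝ) : TopologicalSpace.Opens (LinearMap.ker (nu N Γ)) where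
  carrier := {z | (z : Fin (N + 1) → ℂ) ∈ Psing N Γ}
  is_open' := by
    have h : {z : LinearMap.ker (nu N Γ) | (z : Fin (N + 1) → ℂ) ∈ Psing N Γ} =
        ⋂ (m : Fin (N + 1)) (n : Fin (N + 1)) (_ : m ≠ n),
          {z : LinearMap.ker (nu N Γ) |
            (z : Fin (N + 1) → ℂ) m ≠ (z : Fin (N + 1) → ℂ) n} := by
      ext z
      have hz : nu N Γ (z : Fin (N + 1) → ℂ) = 0 := z.2
      simp only [Psing, P, hz, and_true, Set.mem_ofPred_eq, Set.mem_iInter]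
      exact ⟨fun h m n hmn e => hmn (h e), fun h m n e => by_contra fun hmn => h m n hmn e⟩
    rw [h]
    refine isOpen_iInter_of_finite fun m => isOpen_iInter_of_finite fun n =>
      isOpen_iInter_of_finite fun _ => isOpen_ne_fun ?_ ?_
    · exact (continuous_apply m).comp continuous_subtype_val
    · exact (continuous_apply n).comp continuous_subtype_val

/-- `P₁^sing` as a manifold: since `u₀ = 0` there, an open subset of the vector space `W`. -/
def P1singM (N : ℕ) : TopologicalSpace.Opens (W N) where
  carrier := {w | ((0 : ℝ), w) ∈ P1sing N}
  is_open' := by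
    have h : {w : W N | ((0 : ℝ), w) ∈ P1sing N} =
        (⋂ (m : Fin N) (n : Fin N) (_ : m ≠ n),
          {w : W N | (w : Fin N → ℂ) m ≠ (w : Fin N → ℂ) n}) ∩
        ⋂ (n : Fin N), {w : W N | (w : Fin N → ℂ) n ≠ 0} := by
      ext w
      simp only [P1sing, P1, le_refl, true_and, and_true, Set.mem_ofPred_eq, Set.mem_iInter,
        Set.mem_inter_iff, Complex.ofReal_zero, zero_div, add_zero]
      refine and_congr_left fun _ => ?_
      exact ⟨fun h m n hmn e => hmn (h e), fun h m n e => by_contra fun hmn => h m n hmn e⟩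
    rw [h]
    have hc : ∀ m : Fin N, Continuous fun w : W N => (w : Fin N → ℂ) m :=
      fun m => (continuous_apply m).comp continuous_subtype_val
    refine IsOpen.inter ?_ ?_
    · exact isOpen_iInter_of_finite fun m => isOpen_iInter_of_finite fun n =>
        isOpen_iInter_of_finite fun _ => isOpen_ne_fun (hc m) (hc n)
    · exact isOpen_iInter_of_finite fun n => isOpen_ne_fun (hc n) continuous_const

/-- Lying in the same `SE(2)`-orbit, on `P^sing`. -/
abbrev psingSetoid (N : ℕ) (Γ : ℝ) : Setoid (PsingM N Γ) :=
  (MulAction.orbitRel SE2 (Fin (N + 1) → ℂ)).comap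
    fun z : PsingM N Γ => ((z : LinearMap.ker (nu N Γ)) : Fin (N + 1) → ℂ)

/-- Lying in the same `SO(2)`-orbit, on `P₁^sing`, for the action `A (u₁, …, u_N) =
(A u₁, …, A u_N)`. -/
abbrev p1singSetoid (N : ℕ) : Setoid (P1singM N) :=
  (MulAction.orbitRel Circle (W N)).comap fun w : P1singM N => (w : W N)

/-- The orbit space `P^sing / SE(2)`, with the quotient topology. -/
abbrev PsingQuot (N : ℕ) (Γ : ℝ) : Type := Quotient (psingSetoid N Γ)

/-- The orbit space `P₁^sing / SO(2)`, with the quotient topology. -/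
abbrev P1singQuot (N : ℕ) : Type := Quotient (p1singSetoid N)

/-- A smooth structure on the quotient space `M / r`, with charts in `ℝ^d`, is a quotient manifold
structure: `M / r` is a manifold (Hausdorff and second countable, for the quotient topology) and
the canonical map `M → M / r` is a smooth submersion. There is at most one such structure. -/
structure IsQuotientManifold (E : Type*) {M : Type*} [NormedAddCommGroup E] [NormedSpace ℝ E]
    [TopologicalSpace M] [ChartedSpace E M] (r : Setoid M) (d : ℕ)
    [ChartedSpace (EuclideanSpace ℝ (Fin d)) (Quotient r)] : Prop where
  isManifold : IsManifold (𝓡 d) ∞ (Quotient r)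
  t2 : T2Space (Quotient r)
  secondCountable : SecondCountableTopology (Quotient r)
  smooth_mk : ContMDiff 𝓘(ℝ, E) (𝓡 d) ∞ (Quotient.mk r)
  submersion_mk : ∀ x : M,
    Function.Surjective (mfderiv 𝓘(ℝ, E) (𝓡 d) (Quotient.mk r) x)

/-- The `SE(2)`-invariant open subsets of the phase space `P`. -/
def IsInvariantOpen (N : ℕ) (U : Set (Fin (N + 1) → ℂ)) : Prop :=
  IsOpen U ∧ U ⊆ P N ∧ ∀ g : SE2, g • U = U

/-- `f` is an `SE(2)`-invariant smooth function on the `SE(2)`-invariant open set `U`. -/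
def IsInvariantSmooth {N : ℕ} (U : Set (Fin (N + 1) → ℂ)) (f : (Fin (N + 1) → ℂ) → ℝ) : Prop :=
  ContDiffOn ℝ ∞ f U ∧ ∀ g : SE2, ∀ z ∈ U, f (g • z) = f z

end VortexResolution

end

noncomputable section

namespace VortexResolution

variable {N : ℕ} {Γ : ℝ}

open scoped Topology
open TopologicalSpace Topology

/-! ### The action of `SE(2)` on configurations -/

/-! The strengths sum to zero, so ν is iΓ/N times s = `relSum N z`, the sum of the satellite
positions relative to the central vortex (`nu_eq`). Hence ν is translation invariant and only turns
under rotations. Where s ≠ 0, exactly one motion carries z₀ to 0 and s to the positive real axis. It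
puts z into the form ι(π(z)), which separates orbits (`proj_eq_proj_iff`) and carries the invariant
Hamiltonian along.

For the bracket, a translation-invariant differential has satellite components a + bₙ with ∑ bₙ = 0
and central component -N a. The a-terms of the bracket weigh N²/Γ at the centre and -N²/Γ at the
satellites, so they cancel and only the bₙ remain (`sum_area_strength`). That is the bracket of P₁,
in which u₀ is only a parameter. Neither it nor H ∘ ι is singular at u₀ = 0, so both extend to the
boundary.

Where s = 0, the differential of a function vanishing on ν = 0 factors through ν. Its Hamiltonian
vector is therefore a translation, which annihilates invariant functions
(`bracketP_eq_zero_of_eqOn_Psing`). Translating z₀ to 0 reduces `SE2`-orbits to rotation orbits of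
satellites. No satellite sits at 0, so turning a chosen one onto the positive axis is a global
slice, and one chart covers each orbit space (`isClassifyingMap_P1sing`, `isClassifyingMap_Psing`).

For the dynamics, the field on P₁ is the relative part of the vortex field (`bracketP1_HP1_eq`).
Through ι it becomes the vortex field minus the velocity of the central vortex. Integral curves on
the two sides thus differ by the motion of z₀, and translations alone suffice for g(t). -/

@[simp] theorem SE2.smul_apply {k : ℕ} (g : SE2) (z : Fin k → ℂ) (n : Fin k) :
    (g • z) n = g.rot * z n + g.trans := rfl

attribute [simp] SE2.smul_def

/-- The total relative position `∑ₘ (zₘ - z₀)` of the satellite vortices. -/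
def relSum (N : ℕ) (z : Fin (N + 1) → ℂ) : ℂ := ∑ m : Fin N, (z m.succ - z 0)

/-- The coefficient of z₀ is minus the sum of the others, so only differences zₘ - z₀ survive. -/
theorem nu_eq (hN : N ≠ 0) (z : Fin (N + 1) → ℂ) :
    nu N Γ z = Complex.I * Γ / N * relSum N z := by
  have hN' : (N : ℂ) ≠ 0 := by exact_mod_cast hN
  rw [nu, LinearMap.sum_apply]
  simp only [strength, relSum, LinearMap.smul_apply, LinearMap.proj_apply,
    Fin.sum_univ_succ, Fin.cons_zero, Fin.cons_succ, Finset.sum_sub_distrib, Finset.sum_const,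
    Finset.card_univ, Fintype.card_fin, smul_eq_mul, nsmul_eq_mul, ← Finset.mul_sum]
  push_cast
  field_simp
  ring

theorem nu_eq_zero_iff (hN : N ≠ 0) (hΓ : Γ ≠ 0) (z : Fin (N + 1) → ℂ) :
    nu N Γ z = 0 ↔ relSum N z = 0 := by
  have hN' : (N : ℂ) ≠ 0 := by exact_mod_cast hN
  rw [nu_eq hN]
  simp [hN', hΓ, Complex.I_ne_zero]

theorem relSum_smul (g : SE2) (z : Fin (N + 1) → ℂ) :
    relSum N (g • z) = g.rot * relSum N z := by
  simp only [relSum, Finset.mul_sum]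
  exact Finset.sum_congr rfl fun n _ => by simp [mul_sub]

theorem smul_mem_P (g : SE2) {z : Fin (N + 1) → ℂ} : g • z ∈ P N ↔ z ∈ P N := by
  refine ⟨fun h m n e => h (by simp [e]), fun h m n e => h ?_⟩
  simpa using e

theorem mem_Psing (hN : N ≠ 0) (hΓ : Γ ≠ 0) {z : Fin (N + 1) → ℂ} :
    z ∈ Psing N Γ ↔ z ∈ P N ∧ relSum N z = 0 := by
  rw [← nu_eq_zero_iff hN hΓ]; rfl

theorem mem_Preg (hN : N ≠ 0) (hΓ : Γ ≠ 0) {z : Fin (N + 1) → ℂ} :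
    z ∈ Preg N Γ ↔ z ∈ P N ∧ relSum N z ≠ 0 := by
  rw [Preg, Set.mem_sdiff, mem_Psing hN hΓ]; tauto

theorem smul_mem_Psing (hN : N ≠ 0) (hΓ : Γ ≠ 0) (g : SE2) {z : Fin (N + 1) → ℂ} :
    g • z ∈ Psing N Γ ↔ z ∈ Psing N Γ := by
  simp [mem_Psing hN hΓ, smul_mem_P, relSum_smul]

theorem smul_mem_Preg (hN : N ≠ 0) (hΓ : Γ ≠ 0) (g : SE2) {z : Fin (N + 1) → ℂ} :
    g • z ∈ Preg N Γ ↔ z ∈ Preg N Γ := by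
  simp [mem_Preg hN hΓ, smul_mem_P, relSum_smul]

theorem smul_set_eq_of_forall_mem {G α : Type*} [Group G] [MulAction G α] {S : Set α}
    (h : ∀ (g : G) (x : α), x ∈ S → g • x ∈ S) (g : G) : g • S = S := by
  ext x
  rw [Set.mem_smul_set_iff_inv_smul_mem]
  exact ⟨fun hx => by simpa using h g _ hx, h g⁻¹ x⟩

/-! ### The two sectors and their topology -/

theorem Preg_union_Psing : Preg N Γ ∪ Psing N Γ = P N :=
  Set.sdiff_union_of_subset fun _ h => h.1

theorem disjoint_Preg_Psing : Disjoint (Preg N Γ) (Psing N Γ) := Set.disjoint_sdiff_left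

theorem P1reg_union_P1sing : P1reg N ∪ P1sing N = P1 N :=
  Set.sdiff_union_of_subset fun _ h => h.1

theorem disjoint_P1reg_P1sing : Disjoint (P1reg N) (P1sing N) := Set.disjoint_sdiff_left

theorem isOpen_P : IsOpen (P N) := by
  have h : P N = ⋂ (m : Fin (N + 1)) (n : Fin (N + 1)) (_ : m ≠ n), {z | z m ≠ z n} := by
    ext z
    simp only [P, Set.mem_ofPred_eq, Set.mem_iInter]
    exact ⟨fun h m n hmn e => hmn (h e), fun h m n e => by_contra fun hmn => h m n hmn e⟩
  rw [h]
  exact isOpen_iInter_of_finite fun m => isOpen_iInter_of_finite fun n =>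
    isOpen_iInter_of_finite fun _ => isOpen_ne_fun (continuous_apply m) (continuous_apply n)

theorem continuous_relSum : Continuous (relSum N) := by
  unfold relSum; fun_prop

theorem isOpen_Preg (hN : N ≠ 0) (hΓ : Γ ≠ 0) : IsOpen (Preg N Γ) := by
  have h : Preg N Γ = P N ∩ {z | relSum N z ≠ 0} := by ext z; exact mem_Preg hN hΓ
  rw [h]
  exact isOpen_P.inter (isOpen_ne_fun continuous_relSum continuous_const)

theorem surjective_nu (hΓ : Γ ≠ 0) : Function.Surjective (nu N Γ) := by
  have hΓ' : (Γ : ℂ) ≠ 0 := by exact_mod_cast hΓ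
  intro v
  refine ⟨Pi.single 0 (Complex.I / Γ * v), ?_⟩
  simp only [nu, LinearMap.sum_apply, LinearMap.smul_apply, LinearMap.proj_apply, smul_eq_mul]
  rw [Fin.sum_univ_succ]
  simp only [strength, Fin.cons_zero, Pi.single_eq_same, Pi.single_eq_of_ne (Fin.succ_ne_zero _),
    mul_zero, Finset.sum_const_zero, add_zero]
  have h : -Complex.I * Γ * (Complex.I / Γ * v) = -(Complex.I * Complex.I) * v := by
    field_simp
  rw [h, Complex.I_mul_I]; ring

/-- A proper real subspace has empty interior, and ν = 0 is proper because moving the central vortex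
alone changes ν. -/
theorem P_subset_closure_Preg (hN : N ≠ 0) (hΓ : Γ ≠ 0) : P N ⊆ closure (Preg N Γ) := by
  have hd : Dense {z : Fin (N + 1) → ℂ | relSum N z ≠ 0} := by
    have h0 : (Pi.single 0 1 : Fin (N + 1) → ℂ) ∉ (LinearMap.ker (nu N Γ)) := by
      rw [LinearMap.mem_ker, nu_eq_zero_iff hN hΓ]
      simp [relSum, hN]
    have hc : {z : Fin (N + 1) → ℂ | relSum N z ≠ 0} =
        (LinearMap.ker (nu N Γ) : Set (Fin (N + 1) → ℂ))ᶜ := by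
      ext z
      simp [nu_eq_zero_iff hN hΓ]
    rw [hc, ← interior_eq_empty_iff_dense_compl, ← Set.not_nonempty_iff_eq_empty]
    exact fun h => h0 (Submodule.eq_top_of_nonempty_interior' _ h ▸ Submodule.mem_top)
  have h := hd.open_subset_closure_inter (isOpen_P (N := N))
  refine h.trans (closure_mono fun z hz => (mem_Preg hN hΓ).2 hz)

/-! ### The standard gauge and the projection -/

@[simp] theorem sect_zero (u : ℝ × W N) : sect N u 0 = 0 := rfl

@[simp] theorem sect_succ (u : ℝ × W N) (n : Fin N) :
    sect N u n.succ = (u.2 : Fin N → ℂ) n + (u.1 : ℂ) / N := rfl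

theorem relSum_sect (hN : N ≠ 0) (u : ℝ × W N) : relSum N (sect N u) = u.1 := by
  have hN' : (N : ℂ) ≠ 0 := by exact_mod_cast hN
  have h := mem_W.1 u.2.2
  simp only [relSum, sect_succ, sect_zero, sub_zero, Finset.sum_add_distrib, h]
  simp [mul_div_cancel₀ _ hN']

theorem mem_P1 {u : ℝ × W N} : u ∈ P1 N ↔ 0 ≤ u.1 ∧ sect N u ∈ P N := by
  refine and_congr_right fun _ => ?_
  change _ ↔ Function.Injective (Fin.cons _ _ : Fin (N + 1) → ℂ)
  rw [Fin.cons_injective_iff, and_comm]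
  refine and_congr ?_ ?_
  · simp
  · exact ⟨fun h m n e => h (add_right_cancel e), fun h m n e => h (by simp [e])⟩

theorem mem_P1sing {u : ℝ × W N} : u ∈ P1sing N ↔ u.1 = 0 ∧ sect N u ∈ P N := by
  rw [P1sing, Set.mem_ofPred_eq, mem_P1]
  exact ⟨fun h => ⟨h.2, h.1.2⟩, fun h => ⟨⟨h.1.ge, h.2⟩, h.1⟩⟩

theorem mem_P1reg {u : ℝ × W N} : u ∈ P1reg N ↔ 0 < u.1 ∧ sect N u ∈ P N := by
  rw [P1reg, Set.mem_sdiff, mem_P1sing, mem_P1]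
  constructor
  · rintro ⟨h, h'⟩
    exact ⟨lt_of_le_of_ne h.1 fun e => h' ⟨e.symm, h.2⟩, h.2⟩
  · rintro ⟨h, h'⟩
    exact ⟨⟨h.le, h'⟩, fun e => h.ne' e.1⟩

theorem mapsTo_sect_P1 : Set.MapsTo (sect N) (P1 N) (P N) := fun _ h => (mem_P1.1 h).2

theorem injective_sect (hN : N ≠ 0) : Function.Injective (sect N) := by
  intro u v h
  have h1 : u.1 = v.1 := by
    have := congrArg (relSum N) h
    simpa [relSum_sect hN] using this
  refine Prod.ext h1 (Subtype.ext (funext fun n => ?_))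
  have := congrFun h n.succ
  simpa [h1] using this

theorem mapsTo_sect_P1reg (hN : N ≠ 0) (hΓ : Γ ≠ 0) :
    Set.MapsTo (sect N) (P1reg N) (Preg N Γ) := fun u h => by
  rw [mem_Preg hN hΓ, relSum_sect hN]
  exact ⟨(mem_P1reg.1 h).2, by exact_mod_cast (mem_P1reg.1 h).1.ne'⟩

theorem mapsTo_sect_P1sing (hN : N ≠ 0) (hΓ : Γ ≠ 0) :
    Set.MapsTo (sect N) (P1sing N) (Psing N Γ) := fun u h => by
  rw [mem_Psing hN hΓ, relSum_sect hN]
  exact ⟨(mem_P1sing.1 h).2, by exact_mod_cast (mem_P1sing.1 h).1⟩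

theorem sect_circle_smul (A : Circle) (u : ℝ × W N) (hu : u.1 = 0) :
    sect N (u.1, A • u.2) = SE2.ofCircle A • sect N u := by
  ext n
  refine Fin.cases ?_ (fun n => ?_) n
  · simp [SE2.ofCircle]
  · simp [SE2.ofCircle, hu, Circle.smul_def]

theorem circle_smul_mem_P1sing (A : Circle) {u : ℝ × W N} (hu : u ∈ P1sing N) :
    (u.1, A • u.2) ∈ P1sing N := by
  rw [mem_P1sing] at hu ⊢
  rw [sect_circle_smul A u hu.1, smul_mem_P]
  exact hu

/-- The regular N-gon of roots of unity about the central vortex; its centre of mass is 0 because N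
≥ 2. -/
theorem exists_mem_P1sing (hN : 2 ≤ N) : ∃ w : W N, ((0 : ℝ), w) ∈ P1sing N := by
  have hN' : N ≠ 0 := by omega
  have hζ := Complex.isPrimitiveRoot_exp N hN'
  set ζ := Complex.exp (2 * Real.pi * Complex.I / N)
  refine ⟨⟨fun n => ζ ^ (n : ℕ), ?_⟩, ⟨le_rfl, ?_, fun n => ?_⟩, rfl⟩
  · rw [mem_W, Fin.sum_univ_eq_sum_range (fun i => ζ ^ i), hζ.geom_sum_eq_zero (by omega)]
  · exact fun m n h => Fin.ext (hζ.pow_inj m.2 n.2 h)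
  · simpa using pow_ne_zero _ (hζ.ne_zero hN')

theorem stabilizer_sect_P1sing (hN : 2 ≤ N) :
    MulAction.stabilizer SE2 (sect N '' P1sing N) = SO2 := by
  ext g
  rw [MulAction.mem_stabilizer_iff]
  constructor
  · intro h
    obtain ⟨w, hw⟩ := exists_mem_P1sing hN
    have h1 : g • sect N (0, w) ∈ sect N '' P1sing N :=
      h ▸ Set.smul_mem_smul_set (Set.mem_image_of_mem _ hw)
    obtain ⟨v, -, hv⟩ := h1
    -- Every gauge configuration has its central vortex at 0, and g moves 0 to its translation part.
    have h2 := congrFun hv 0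
    refine ⟨g.rot, SE2.ext rfl ?_⟩
    simpa [SE2.ofCircle] using h2
  · rintro ⟨A, rfl⟩
    have key : ∀ (A : Circle) (x : Fin (N + 1) → ℂ), x ∈ sect N '' P1sing N →
        SE2.ofCircle A • x ∈ sect N '' P1sing N := by
      rintro A _ ⟨u, hu, rfl⟩
      exact ⟨_, circle_smul_mem_P1sing A hu, sect_circle_smul A u (mem_P1sing.1 hu).1⟩
    ext x
    rw [Set.mem_smul_set_iff_inv_smul_mem]
    refine ⟨fun hx => by simpa using key A _ hx, fun hx => ?_⟩
    rw [← map_inv]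
    exact key _ _ hx

/-! ### The normal form on the regular sector -/

theorem proj_fst (z : Fin (N + 1) → ℂ) : (proj N z).1 = ‖relSum N z‖ := rfl

theorem proj_snd_apply (z : Fin (N + 1) → ℂ) (n : Fin N) :
    ((proj N z).2 : Fin N → ℂ) n =
      (‖relSum N z‖ : ℂ) * (z n.succ - z 0) * (relSum N z)⁻¹ - (‖relSum N z‖ : ℂ) / N := rfl

theorem proj_smul (g : SE2) (z : Fin (N + 1) → ℂ) : proj N (g • z) = proj N z := by
  refine Prod.ext ?_ (Subtype.ext (funext fun n => ?_))
  · simp [proj_fst, relSum_smul, Circle.norm_coe]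
  · have h : (g.rot : ℂ) ≠ 0 := g.rot.coe_ne_zero
    rw [proj_snd_apply, proj_snd_apply, relSum_smul]
    simp only [norm_mul, Circle.norm_coe, one_mul, SE2.smul_apply, mul_inv]
    congr 1
    field_simp
    ring

theorem proj_sect (hN : N ≠ 0) {u : ℝ × W N} (hu : 0 < u.1) : proj N (sect N u) = u := by
  have hu' : (u.1 : ℂ) ≠ 0 := by exact_mod_cast hu.ne'
  have hn : ‖(u.1 : ℂ)‖ = u.1 := by simp [abs_of_pos hu]
  refine Prod.ext ?_ (Subtype.ext (funext fun n => ?_))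
  · rw [proj_fst, relSum_sect hN, hn]
  · rw [proj_snd_apply, relSum_sect hN, hn]
    simp [mul_right_comm, hu']

/-- The unit complex number that rotates `s` onto the positive real axis. -/
def unrot (s : ℂ) : ℂ := (‖s‖ : ℂ) * s⁻¹

theorem norm_unrot {s : ℂ} (hs : s ≠ 0) : ‖unrot s‖ = 1 := by
  simp [unrot, hs]

/-- The element of `SE(2)` that moves a configuration into the standard gauge. -/
theorem exists_smul_eq_sect_proj {z : Fin (N + 1) → ℂ} (hz : relSum N z ≠ 0) :
    ∃ g : SE2, g • z = sect N (proj N z) := by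
  let A : Circle := ⟨unrot (relSum N z), by simp [Submonoid.unitSphere, norm_unrot hz]⟩
  refine ⟨⟨A, -(A * z 0)⟩, funext fun n => ?_⟩
  refine Fin.cases ?_ (fun n => ?_) n
  · simp
  · rw [sect_succ, proj_snd_apply, proj_fst]
    simp [A, unrot]
    ring

theorem proj_eq_proj_iff (hN : N ≠ 0) (hΓ : Γ ≠ 0) {z z' : Fin (N + 1) → ℂ} (hz : z ∈ Preg N Γ)
    (hz' : z' ∈ Preg N Γ) : proj N z = proj N z' ↔ ∃ g : SE2, g • z = z' := by
  constructor
  · intro h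
    obtain ⟨g, hg⟩ := exists_smul_eq_sect_proj ((mem_Preg hN hΓ).1 hz).2
    obtain ⟨g', hg'⟩ := exists_smul_eq_sect_proj ((mem_Preg hN hΓ).1 hz').2
    exact ⟨g'⁻¹ * g, by rw [mul_smul, hg, h, ← hg', inv_smul_smul]⟩
  · rintro ⟨g, rfl⟩
    exact (proj_smul g z).symm

theorem image_proj_Preg (hN : N ≠ 0) (hΓ : Γ ≠ 0) : proj N '' Preg N Γ = P1reg N := by
  apply Set.Subset.antisymm
  · rintro _ ⟨z, hz, rfl⟩
    have hz' := (mem_Preg hN hΓ).1 hz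
    obtain ⟨g, hg⟩ := exists_smul_eq_sect_proj hz'.2
    rw [mem_P1reg, ← hg, smul_mem_P]
    exact ⟨norm_pos_iff.2 hz'.2, hz'.1⟩
  · intro u hu
    exact ⟨sect N u, mapsTo_sect_P1reg hN hΓ hu, proj_sect hN (mem_P1reg.1 hu).1⟩

/-! ### The vortex bracket of linear functionals -/

/-- If `F` is affine on a short segment through `x`, its derivative there is the slope. -/
theorem hasFDerivAt_apply_eq_of_eventually {E F : Type*} [NormedAddCommGroup E] [NormedSpace ℝ E]
    [NormedAddCommGroup F] [NormedSpace ℝ F] {f : E → F} {f' : E →L[ℝ] F} {x v : E} {w : F}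
    (hf : HasFDerivAt f f' x) (h : ∀ᶠ t : ℝ in 𝓝 0, f (x + t • v) = f x + t • w) : f' v = w := by
  have h1 : HasDerivAt (fun t : ℝ => f (x + t • v)) (f' v) 0 := hf.hasLineDerivAt v
  have h2 : HasDerivAt (fun t : ℝ => f x + t • w) w 0 := by
    simpa using ((hasDerivAt_id (0 : ℝ)).smul_const w).const_add (f x)
  exact (h1.congr_of_eventuallyEq (h.mono fun _ h => h.symm)).unique h2

/-- The canonical area form on real linear functionals on the plane. -/
def area (L M : ℂ →L[ℝ] ℝ) : ℝ := L 1 * M Complex.I - L Complex.I * M 1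

/-- The multiplication by a complex number as a real linear map. -/
def mulC (A : ℂ) : ℂ →L[ℝ] ℂ := ContinuousLinearMap.mul ℝ ℂ A

@[simp] theorem mulC_apply (A v : ℂ) : mulC A v = A * v := rfl

theorem apply_eq_re_im (L : ℂ →L[ℝ] ℝ) (v : ℂ) : L v = v.re * L 1 + v.im * L Complex.I := by
  conv_lhs => rw [← Complex.re_add_im v]
  have h1 : (v.re : ℂ) = v.re • (1 : ℂ) := by simp
  have h2 : (v.im : ℂ) * Complex.I = v.im • Complex.I := by simp
  rw [h1, h2, map_add, map_smul, map_smul, smul_eq_mul, smul_eq_mul]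

/-- Multiplication by A has real determinant |A|², so rotations preserve the area form and with it
the bracket. -/
theorem area_comp_mulC (A : ℂ) (L M : ℂ →L[ℝ] ℝ) :
    area (L.comp (mulC A)) (M.comp (mulC A)) = ‖A‖ ^ 2 * area L M := by
  have h : ‖A‖ ^ 2 = A.re * A.re + A.im * A.im := by
    rw [Complex.sq_norm, Complex.normSq_apply]
  simp only [area, ContinuousLinearMap.comp_apply, mulC_apply, mul_one, h]
  rw [apply_eq_re_im L A, apply_eq_re_im M A, apply_eq_re_im L (A * _),
    apply_eq_re_im M (A * _)]
  simp
  ring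

theorem area_add_left (L L' M : ℂ →L[ℝ] ℝ) : area (L + L') M = area L M + area L' M := by
  simp [area]; ring

theorem area_add_right (L M M' : ℂ →L[ℝ] ℝ) : area L (M + M') = area L M + area L M' := by
  simp [area]; ring

theorem area_smul_left (c : ℝ) (L M : ℂ →L[ℝ] ℝ) : area (c • L) M = c * area L M := by
  simp [area]; ring

theorem area_smul_right (c : ℝ) (L M : ℂ →L[ℝ] ℝ) : area L (c • M) = c * area L M := by
  simp [area]; ring

theorem sum_area_left {ι : Type*} (s : Finset ι) (L : ι → ℂ →L[ℝ] ℝ) (M : ℂ →L[ℝ] ℝ) :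
    ∑ i ∈ s, area (L i) M = area (∑ i ∈ s, L i) M := by
  simp [area, Finset.sum_mul]

theorem sum_area_right {ι : Type*} (s : Finset ι) (L : ℂ →L[ℝ] ℝ) (M : ι → ℂ →L[ℝ] ℝ) :
    ∑ i ∈ s, area L (M i) = area L (∑ i ∈ s, M i) := by
  simp [area, Finset.mul_sum]

/-- The restriction of a functional on configurations to the displacements of one vortex. -/
def slot {k : ℕ} (L : (Fin k → ℂ) →L[ℝ] ℝ) (n : Fin k) : ℂ →L[ℝ] ℝ :=
  L.comp (ContinuousLinearMap.single ℝ (fun _ => ℂ) n)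

@[simp] theorem slot_apply {k : ℕ} (L : (Fin k → ℂ) →L[ℝ] ℝ) (n : Fin k) (v : ℂ) :
    slot L n v = L (Pi.single n v) := rfl

theorem vortexBracket_eq {k : ℕ} (Γ : Fin k → ℝ) (f g : (Fin k → ℂ) → ℝ) (z : Fin k → ℂ) :
    vortexBracket Γ f g z =
      ∑ n, (1 / Γ n) * area (slot (fderiv ℝ f z) n) (slot (fderiv ℝ g z) n) := rfl

theorem apply_eq_sum_slot {k : ℕ} (L : (Fin k → ℂ) →L[ℝ] ℝ) (v : Fin k → ℂ) :
    L v = ∑ n, slot L n (v n) := by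
  conv_lhs => rw [← Finset.univ_sum_single v]
  simp

theorem sum_slot_eq_zero {k : ℕ} {L : (Fin k → ℂ) →L[ℝ] ℝ} (h : ∀ v : ℂ, L (fun _ => v) = 0) :
    ∑ n, slot L n = 0 := by
  ext1 v
  rw [sum_apply, ← apply_eq_sum_slot L (fun _ => v), h]
  rfl

/-- The Hamiltonian vector generated in one plane of strength `γ` by the functional `L`. -/
def hamVec (γ : ℝ) (L : ℂ →L[ℝ] ℝ) : ℂ := (1 / γ : ℝ) * (L Complex.I - L 1 * Complex.I)

theorem apply_hamVec (γ : ℝ) (L M : ℂ →L[ℝ] ℝ) : L (hamVec γ M) = (1 / γ) * area L M := by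
  rw [apply_eq_re_im, hamVec, area]
  simp
  ring

/-- The Hamiltonian vector field of `H` in the vortex system. -/
def hamField {k : ℕ} (Γ : Fin k → ℝ) (H : (Fin k → ℂ) → ℝ) (z : Fin k → ℂ) : Fin k → ℂ :=
  fun n => hamVec (Γ n) (slot (fderiv ℝ H z) n)

theorem vortexBracket_eq_fderiv_hamField {k : ℕ} (Γ : Fin k → ℝ) (f H : (Fin k → ℂ) → ℝ)
    (z : Fin k → ℂ) : vortexBracket Γ f H z = fderiv ℝ f z (hamField Γ H z) := by
  rw [vortexBracket_eq, apply_eq_sum_slot]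
  exact Finset.sum_congr rfl fun n _ => (apply_hamVec _ _ _).symm

theorem contDiffOn_hamField {k : ℕ} (Γ : Fin k → ℝ) {H : (Fin k → ℂ) → ℝ} {U : Set (Fin k → ℂ)}
    (hU : IsOpen U) (hH : ContDiffOn ℝ ∞ H U) : ContDiffOn ℝ ∞ (hamField Γ H) U := by
  have h := hH.fderiv_of_isOpen hU (m := ∞) le_rfl
  have h' : ∀ v : Fin k → ℂ, ContDiffOn ℝ ∞ (fun z => ((fderiv ℝ H z v : ℝ) : ℂ)) U := fun v =>
    Complex.ofRealCLM.contDiff.comp_contDiffOn (h.clm_apply contDiffOn_const)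
  refine contDiffOn_pi.2 fun n => contDiffOn_const.mul ?_
  exact (h' _).sub ((h' _).mul contDiffOn_const)

theorem contDiffOn_vortexBracket {k : ℕ} (Γ : Fin k → ℝ) {f g : (Fin k → ℂ) → ℝ}
    {U : Set (Fin k → ℂ)} (hU : IsOpen U) (hf : ContDiffOn ℝ ∞ f U) (hg : ContDiffOn ℝ ∞ g U) :
    ContDiffOn ℝ ∞ (vortexBracket Γ f g) U := by
  have h : vortexBracket Γ f g = fun z => fderiv ℝ f z (hamField Γ g z) :=
    funext (vortexBracket_eq_fderiv_hamField Γ f g)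
  rw [h]
  exact (hf.fderiv_of_isOpen hU (m := ∞) le_rfl).clm_apply (contDiffOn_hamField Γ hU hg)

/-! ### Invariant functions -/

theorem hasFDerivAt_smul {k : ℕ} (g : SE2) (z : Fin k → ℂ) :
    HasFDerivAt (fun w : Fin k → ℂ => g • w)
      (ContinuousLinearMap.pi fun n => (mulC g.rot).comp (ContinuousLinearMap.proj (R := ℝ) (φ := fun _ : Fin k => ℂ) n)) z := by
  rw [hasFDerivAt_pi]
  intro n
  exact (((mulC g.rot).comp (ContinuousLinearMap.proj (R := ℝ)
    (φ := fun _ : Fin k => ℂ) n)).hasFDerivAt).add_const g.trans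

theorem slot_fderiv_smul {k : ℕ} {f : (Fin k → ℂ) → ℝ} {g : SE2} {z : Fin k → ℂ}
    (hf : DifferentiableAt ℝ f (g • z)) (h : ∀ᶠ w in 𝓝 z, f (g • w) = f w) (n : Fin k) :
    slot (fderiv ℝ f z) n = (slot (fderiv ℝ f (g • z)) n).comp (mulC g.rot) := by
  have h1 := (hf.hasFDerivAt.comp z (hasFDerivAt_smul g z)).congr_of_eventuallyEq
    (h.mono fun _ h => h.symm)
  ext1 v
  rw [slot_apply, h1.fderiv]
  simp only [ContinuousLinearMap.comp_apply, slot_apply, mulC_apply]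
  congr 1
  ext m
  rcases eq_or_ne m n with rfl | hmn
  · simp
  · simp [hmn]

/-- Translation orbits are straight lines in the direction (v, …, v), and f is constant on them. -/
theorem fderiv_const_eq_zero {k : ℕ} {f : (Fin k → ℂ) → ℝ} {z : Fin k → ℂ}
    (hf : DifferentiableAt ℝ f z) (h : ∀ g : SE2, f (g • z) = f z) (v : ℂ) :
    fderiv ℝ f z (fun _ => v) = 0 := by
  refine hasFDerivAt_apply_eq_of_eventually hf.hasFDerivAt (.of_forall fun t => ?_)
  rw [smul_zero, add_zero, ← h ⟨1, t • v⟩]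
  congr 1
  ext n
  simp

theorem vortexBracket_smul {k : ℕ} (Γ : Fin k → ℝ) {f g : (Fin k → ℂ) → ℝ} {a : SE2}
    {z : Fin k → ℂ} (hf : DifferentiableAt ℝ f (a • z)) (hf' : ∀ᶠ w in 𝓝 z, f (a • w) = f w)
    (hg : DifferentiableAt ℝ g (a • z)) (hg' : ∀ᶠ w in 𝓝 z, g (a • w) = g w) :
    vortexBracket Γ f g (a • z) = vortexBracket Γ f g z := by
  rw [vortexBracket_eq, vortexBracket_eq]
  refine Finset.sum_congr rfl fun n _ => ?_
  rw [slot_fderiv_smul hf hf', slot_fderiv_smul hg hg', area_comp_mulC, Circle.norm_coe]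
  simp

theorem IsInvariantOpen.smul_mem {U : Set (Fin (N + 1) → ℂ)} (hU : IsInvariantOpen N U) (g : SE2)
    {z : Fin (N + 1) → ℂ} (hz : z ∈ U) : g • z ∈ U := by
  rw [← hU.2.2 g]; exact Set.smul_mem_smul_set hz

theorem isInvariantSmooth_bracketP {U : Set (Fin (N + 1) → ℂ)} (hU : IsInvariantOpen N U)
    {f g : (Fin (N + 1) → ℂ) → ℝ} (hf : IsInvariantSmooth U f) (hg : IsInvariantSmooth U g) :
    IsInvariantSmooth U (bracketP N Γ f g) := by
  refine ⟨contDiffOn_vortexBracket _ hU.1 hf.1 hg.1, fun a z hz => ?_⟩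
  have hz' := hU.1.mem_nhds (hU.smul_mem a hz)
  have hev := hU.1.mem_nhds hz
  exact vortexBracket_smul _ ((hf.1.contDiffAt hz').differentiableAt (by simp))
    (Filter.mem_of_superset hev fun w hw => hf.2 a w hw)
    ((hg.1.contDiffAt hz').differentiableAt (by simp))
    (Filter.mem_of_superset hev fun w hw => hg.2 a w hw)

theorem vortexBracket_eq_zero_of_eqOn {k : ℕ} (Γ : Fin k → ℝ) {f g : (Fin k → ℂ) → ℝ}
    {V : Set (Fin k → ℂ)} (hV : IsOpen V) (hg : ∀ z ∈ V, g z = 0) {z : Fin k → ℂ} (hz : z ∈ V) :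
    vortexBracket Γ f g z = 0 := by
  have h : g =ᶠ[𝓝 z] fun _ => 0 := Filter.mem_of_superset (hV.mem_nhds hz) hg
  simp [vortexBracket, h.fderiv_eq]

theorem strength_ne_zero (hN : N ≠ 0) (hΓ : Γ ≠ 0) (n : Fin (N + 1)) : strength N Γ n ≠ 0 := by
  refine Fin.cases ?_ (fun n => ?_) n
  · simpa [strength] using hΓ
  · simp [strength, hΓ, hN]

/-- The derivative of g kills the kernel of ν, so it factors through ν. Its slots divided by the
strengths then agree, which makes the bracket with f a pairing with the sum of the slots of f, and
this sum is zero by translation invariance. -/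
theorem bracketP_eq_zero_of_eqOn_Psing (hN : N ≠ 0) (hΓ : Γ ≠ 0) {U : Set (Fin (N + 1) → ℂ)}
    (hU : IsInvariantOpen N U) {f g : (Fin (N + 1) → ℂ) → ℝ} (hf : IsInvariantSmooth U f)
    (hg : ContDiffOn ℝ ∞ g U) (h0 : ∀ z ∈ U ∩ Psing N Γ, g z = 0) {z : Fin (N + 1) → ℂ}
    (hz : z ∈ U ∩ Psing N Γ) : bracketP N Γ f g z = 0 := by
  have hzU := hU.1.mem_nhds hz.1
  have hgd : DifferentiableAt ℝ g z := (hg.contDiffAt hzU).differentiableAt (by simp)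
  have hfd : DifferentiableAt ℝ f z := (hf.1.contDiffAt hzU).differentiableAt (by simp)
  have hker : ∀ v, nu N Γ v = 0 → fderiv ℝ g z v = 0 := by
    intro v hv
    refine hasFDerivAt_apply_eq_of_eventually hgd.hasFDerivAt ?_
    have hc : ContinuousAt (fun t : ℝ => z + t • v) 0 := by fun_prop
    have hV : U ∈ 𝓝 (z + (0 : ℝ) • v) := by simpa using hzU
    filter_upwards [hc.preimage_mem_nhds hV] with t ht
    rw [smul_zero, add_zero, h0 z hz]
    refine h0 _ ⟨ht, hU.2.1 ht, ?_⟩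
    rw [map_add, map_smul, hv, hz.2.2, smul_zero, add_zero]
  have hs := sum_slot_eq_zero (fderiv_const_eq_zero hfd fun a => hf.2 a z hz.1)
  -- Displacing vortex n by v/Γₙ and vortex 0 by -v/Γ₀ leaves ν unchanged.
  have key : ∀ n, (1 / strength N Γ n) • slot (fderiv ℝ g z) n =
      (1 / strength N Γ 0) • slot (fderiv ℝ g z) 0 := by
    intro n
    ext1 v
    have h : nu N Γ ((1 / strength N Γ n) • (Pi.single n v : Fin (N + 1) → ℂ) -
        (1 / strength N Γ 0) • (Pi.single 0 v : Fin (N + 1) → ℂ)) = 0 := by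
      have hsing : ∀ m : Fin (N + 1), nu N Γ (Pi.single m v) = -Complex.I * strength N Γ m * v := by
        intro m
        rw [nu, LinearMap.sum_apply, Finset.sum_eq_single m]
        · simp
        · intro b _ hb
          simp [hb]
        · simp
      rw [map_sub, map_smul, map_smul, hsing, hsing]
      have h1 : (strength N Γ n : ℂ) ≠ 0 := by exact_mod_cast strength_ne_zero hN hΓ n
      have h2 : (strength N Γ 0 : ℂ) ≠ 0 := by exact_mod_cast strength_ne_zero hN hΓ 0
      simp only [Complex.real_smul]
      push_cast
      field_simp
      ring
    have h' := hker _ h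
    rw [map_sub, map_smul, map_smul] at h'
    exact sub_eq_zero.1 h'
  rw [bracketP, vortexBracket_eq]
  calc _ = ∑ n, area (slot (fderiv ℝ f z) n) ((1 / strength N Γ 0) • slot (fderiv ℝ g z) 0) :=
        Finset.sum_congr rfl fun n _ => by rw [← key n, area_smul_right]
    _ = 0 := by rw [sum_area_left, hs]; simp [area]

/-! ### The Hamiltonian -/

theorem vortexHamiltonian_smul {k : ℕ} (Γ : Fin k → ℝ) (g : SE2) (z : Fin k → ℂ) :
    vortexHamiltonian Γ (g • z) = vortexHamiltonian Γ z := by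
  have h : ∀ m n, ‖(g • z) m - (g • z) n‖ = ‖z m - z n‖ := fun m n => by
    rw [SE2.smul_apply, SE2.smul_apply, add_sub_add_right_eq_sub, ← mul_sub, norm_mul,
      Circle.norm_coe, one_mul]
  simp only [vortexHamiltonian, h]

theorem contDiffOn_HP : ContDiffOn ℝ ∞ (HP N Γ) (P N) := by
  refine contDiffOn_const.mul (ContDiffOn.sum fun m _ => ContDiffOn.sum fun n _ => ?_)
  split_ifs with h
  · refine contDiffOn_const.mul (ContDiffOn.log ?_ ?_)
    · exact ContDiff.contDiffOn (((contDiff_apply ℝ ℂ m).sub (contDiff_apply ℝ ℂ n)).norm_sq ℝ)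
    · intro z hz
      have : z m - z n ≠ 0 := sub_ne_zero.2 fun e => h (hz e)
      positivity
  · exact contDiffOn_const

theorem differentiableAt_HP {z : Fin (N + 1) → ℂ} (hz : z ∈ P N) :
    DifferentiableAt ℝ (HP N Γ) z :=
  (contDiffOn_HP.contDiffAt (isOpen_P.mem_nhds hz)).differentiableAt (by simp)

/-! ### The gauge maps as linear maps -/

theorem projW_apply (w : Fin N → ℂ) (n : Fin N) :
    (projW N w : Fin N → ℂ) n = w n - (∑ m, w m) / N := rfl

theorem projW_coe (w : W N) : projW N w = w := by
  ext n
  rw [projW_apply, mem_W.1 w.2, zero_div, sub_zero]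

theorem projW_add (v w : Fin N → ℂ) : projW N (v + w) = projW N v + projW N w := by
  ext n
  simp only [projW_apply, Pi.add_apply, Submodule.coe_add, Finset.sum_add_distrib]
  ring

theorem projW_smul (c : ℂ) (w : Fin N → ℂ) : projW N (c • w) = c • projW N w := by
  ext n
  simp only [projW_apply, Pi.smul_apply, Submodule.coe_smul, smul_eq_mul, ← Finset.mul_sum]
  ring

theorem coe_smul_W (c : ℝ) (w : W N) : (c : ℂ) • w = c • w := by
  ext n
  simp

theorem projW_real_smul (c : ℝ) (w : Fin N → ℂ) : projW N (c • w) = c • projW N w := by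
  have h := projW_smul (c : ℂ) w
  rwa [Complex.coe_smul, coe_smul_W] at h

theorem projW_const (hN : N ≠ 0) (c : ℂ) : projW N (fun _ => c) = 0 := by
  have hN' : (N : ℂ) ≠ 0 := by exact_mod_cast hN
  ext n
  simp [projW_apply, hN']

/-- The mean-subtracting projection as a continuous real linear map. -/
def projWL (N : ℕ) : (Fin N → ℂ) →L[ℝ] W N :=
  LinearMap.toContinuousLinearMap
    { toFun := projW N, map_add' := projW_add, map_smul' := projW_real_smul }

/-- The positions of the satellite vortices relative to their centre. -/
def relW (N : ℕ) : (Fin (N + 1) → ℂ) →L[ℝ] W N :=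
  (projWL N).comp
    (ContinuousLinearMap.pi fun n => ContinuousLinearMap.proj (R := ℝ) (φ := fun _ => ℂ) n.succ)

theorem relW_eq (z : Fin (N + 1) → ℂ) : relW N z = projW N (fun n => z n.succ) := rfl

theorem relW_smul (c : ℂ) (z : Fin (N + 1) → ℂ) : relW N (c • z) = c • relW N z :=
  projW_smul c _

theorem relW_apply (z : Fin (N + 1) → ℂ) (n : Fin N) (hN : N ≠ 0) :
    (relW N z : Fin N → ℂ) n = z n.succ - z 0 - relSum N z / N := by
  have hN' : (N : ℂ) ≠ 0 := by exact_mod_cast hN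
  rw [relW_eq, projW_apply, relSum, Finset.sum_sub_distrib]
  simp
  field_simp
  ring

/-- The standard gauge as a continuous linear map. -/
def sectL (N : ℕ) : (ℝ × W N) →L[ℝ] (Fin (N + 1) → ℂ) :=
  LinearMap.toContinuousLinearMap
    { toFun := sect N
      map_add' := fun u v => by
        ext n
        refine Fin.cases ?_ (fun n => ?_) n
        · simp
        · simp; ring
      map_smul' := fun c u => by
        ext n
        refine Fin.cases ?_ (fun n => ?_) n
        · simp
        · simp; ring }

theorem relW_sect (hN : N ≠ 0) (u : ℝ × W N) : relW N (sect N u) = u.2 := by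
  have hN' : (N : ℂ) ≠ 0 := by exact_mod_cast hN
  ext n
  rw [relW_apply _ _ hN, relSum_sect hN]
  simp

theorem contDiff_sect : ContDiff ℝ ∞ (sect N) := (sectL N).contDiff

theorem continuous_sect : Continuous (sect N) := (sectL N).continuous

/-- Gives derivatives within P₁ a meaning at boundary points too, as P₁ is relatively open in a half
space. -/
theorem uniqueDiffOn_P1 : UniqueDiffOn ℝ (P1 N) := by
  have h : P1 N = (Set.Ici 0 ×ˢ Set.univ) ∩ sect N ⁻¹' P N := by
    ext u; rw [mem_P1]; simp
  rw [h]
  exact ((uniqueDiffOn_Ici 0).prod uniqueDiffOn_univ).inter (isOpen_P.preimage continuous_sect)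

theorem isOpen_P1reg : IsOpen (P1reg N) := by
  have h : P1reg N = {u | 0 < u.1} ∩ sect N ⁻¹' P N := by
    ext u; exact mem_P1reg
  rw [h]
  exact (isOpen_lt continuous_const continuous_fst).inter (isOpen_P.preimage continuous_sect)

theorem injective_fderivWithin_sect (hN : N ≠ 0) {u : ℝ × W N} (hu : u ∈ P1 N) :
    Function.Injective (fderivWithin ℝ (sect N) (P1 N) u) := by
  have h : fderivWithin ℝ (sect N) (P1 N) u = sectL N :=
    (sectL N).fderivWithin (uniqueDiffOn_P1 u hu)
  rw [h]
  exact injective_sect hN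

theorem contDiffOn_HP1 : ContDiffOn ℝ ∞ (HP1 N Γ) (P1 N) :=
  contDiffOn_HP.comp contDiff_sect.contDiffOn mapsTo_sect_P1

theorem HP1_proj (hN : N ≠ 0) (hΓ : Γ ≠ 0) {z : Fin (N + 1) → ℂ} (hz : z ∈ Preg N Γ) :
    HP1 N Γ (proj N z) = HP N Γ z := by
  obtain ⟨g, hg⟩ := exists_smul_eq_sect_proj ((mem_Preg hN hΓ).1 hz).2
  rw [HP1, ← hg]
  exact vortexHamiltonian_smul _ g z

/-! ### The bracket on the unified phase space -/

/-- The restriction of a functional on `ℝ × W` to the displacements of one vortex, which are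
projected to `W`. -/
def slotW (L : (ℝ × W N) →L[ℝ] ℝ) (n : Fin N) : ℂ →L[ℝ] ℝ :=
  slot (L.comp ((ContinuousLinearMap.inr ℝ ℝ (W N)).comp (projWL N))) n

@[simp] theorem slotW_apply (L : (ℝ × W N) →L[ℝ] ℝ) (n : Fin N) (v : ℂ) :
    slotW L n v = L (0, projW N (Pi.single n v)) := rfl

theorem sum_slotW (hN : N ≠ 0) (L : (ℝ × W N) →L[ℝ] ℝ) : ∑ n, slotW L n = 0 := by
  refine sum_slot_eq_zero fun v => ?_
  change L (0, projW N (fun _ => v)) = 0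
  rw [projW_const hN]
  exact map_zero L

/-- The bracket differentiates only along displacements that fix u₀. These stay in P₁ even at the
boundary, so a one-sided derivative of f determines it. -/
theorem bracketP1_eq {f g : ℝ × W N → ℝ} {f' g' : (ℝ × W N) →L[ℝ] ℝ} {u : ℝ × W N}
    (hu : u ∈ P1 N) (hf : HasFDerivWithinAt f f' (P1 N) u) (hg : HasFDerivWithinAt g g' (P1 N) u) :
    bracketP1 N Γ f g u = ∑ n, (1 / (-Γ / N)) * area (slotW f' n) (slotW g' n) := by
  have hφ : HasFDerivAt (fun w : Fin N → ℂ => (u.1, projW N w))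
      ((ContinuousLinearMap.inr ℝ ℝ (W N)).comp (projWL N)) (u.2 : Fin N → ℂ) :=
    ((hasFDerivAt_const u.1 _).prodMk (projWL N).hasFDerivAt).congr_fderiv (by ext <;> rfl)
  have hu' : (u.1, projW N (u.2 : Fin N → ℂ)) = u := by rw [projW_coe]
  have hev : ∀ᶠ w in 𝓝 (u.2 : Fin N → ℂ), (u.1, projW N w) ∈ P1 N := by
    have hc : ContinuousAt (fun w : Fin N → ℂ => sect N (u.1, projW N w)) (u.2 : Fin N → ℂ) :=
      (continuous_sect.continuousAt).comp hφ.continuousAt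
    have hP : P N ∈ 𝓝 (sect N (u.1, projW N (u.2 : Fin N → ℂ))) := by
      rw [hu']; exact isOpen_P.mem_nhds (mapsTo_sect_P1 hu)
    filter_upwards [hc.preimage_mem_nhds hP] with w hw
    exact mem_P1.2 ⟨hu.1, hw⟩
  have key : ∀ {f : ℝ × W N → ℝ} {f' : (ℝ × W N) →L[ℝ] ℝ}, HasFDerivWithinAt f f' (P1 N) u →
      fderiv ℝ (fun w => f (u.1, projW N w)) (u.2 : Fin N → ℂ) =
        f'.comp ((ContinuousLinearMap.inr ℝ ℝ (W N)).comp (projWL N)) := by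
    intro f f' hf
    rw [← hu'] at hf
    exact (HasFDerivWithinAt.comp_hasFDerivAt (u.2 : Fin N → ℂ) hf hφ hev).fderiv
  rw [bracketP1, vortexBracket_eq, key hf, key hg]
  rfl

theorem contDiffOn_bracketP1 {f g : ℝ × W N → ℝ} (hf : ContDiffOn ℝ ∞ f (P1 N))
    (hg : ContDiffOn ℝ ∞ g (P1 N)) : ContDiffOn ℝ ∞ (bracketP1 N Γ f g) (P1 N) := by
  have hf' := hf.fderivWithin uniqueDiffOn_P1 (m := ∞) le_rfl
  have hg' := hg.fderivWithin uniqueDiffOn_P1 (m := ∞) le_rfl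
  have h : ContDiffOn ℝ ∞ (fun u => ∑ n, (1 / (-Γ / N)) *
      area (slotW (fderivWithin ℝ f (P1 N) u) n) (slotW (fderivWithin ℝ g (P1 N) u) n))
      (P1 N) := by
    refine ContDiffOn.sum fun n _ => contDiffOn_const.mul ?_
    simp only [area, slotW_apply]
    exact ((hf'.clm_apply contDiffOn_const).mul (hg'.clm_apply contDiffOn_const)).sub
      ((hf'.clm_apply contDiffOn_const).mul (hg'.clm_apply contDiffOn_const))
  refine h.congr fun u hu => bracketP1_eq hu ?_ ?_
  · exact (hf.differentiableOn (by simp) u hu).hasFDerivWithinAt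
  · exact (hg.differentiableOn (by simp) u hu).hasFDerivWithinAt

/-- The total momentum is a Casimir of the bracket of translation-invariant functionals. -/
theorem sum_area_strength (hN : N ≠ 0) (hΓ : Γ ≠ 0) {l m : Fin (N + 1) → ℂ →L[ℝ] ℝ}
    {a a' : ℂ →L[ℝ] ℝ} {b b' : Fin N → ℂ →L[ℝ] ℝ} (hl : ∑ n, l n = 0) (hm : ∑ n, m n = 0)
    (hl' : ∀ n, l n.succ = a + b n) (hm' : ∀ n, m n.succ = a' + b' n) (hb : ∑ n, b n = 0)
    (hb' : ∑ n, b' n = 0) :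
    ∑ n, (1 / strength N Γ n) * area (l n) (m n) =
      ∑ n, (1 / (-Γ / N)) * area (b n) (b' n) := by
  have hN' : (N : ℝ) ≠ 0 := by exact_mod_cast hN
  have key : ∀ {l : Fin (N + 1) → ℂ →L[ℝ] ℝ} {a : ℂ →L[ℝ] ℝ} {b : Fin N → ℂ →L[ℝ] ℝ},
      ∑ n, l n = 0 → (∀ n, l n.succ = a + b n) → ∑ n, b n = 0 → l 0 = (-N : ℝ) • a := by
    intro l a b hl hl' hb
    rw [Fin.sum_univ_succ] at hl
    simp only [hl', Finset.sum_add_distrib, hb, add_zero, Finset.sum_const, Finset.card_univ,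
      Fintype.card_fin] at hl
    rw [eq_neg_of_add_eq_zero_left hl]
    ext1 v
    simp
  rw [Fin.sum_univ_succ, key hl hl' hb, key hm hm' hb']
  simp only [strength, Fin.cons_zero, Fin.cons_succ, hl', hm', area_add_left, area_add_right,
    area_smul_left, area_smul_right, ← Finset.mul_sum, Finset.sum_add_distrib, sum_area_left,
    sum_area_right, hb, hb', Finset.sum_const, Finset.card_univ, Fintype.card_fin, nsmul_eq_mul]
  have h1 : area a 0 = 0 := by simp [area]
  have h2 : area 0 a' = 0 := by simp [area]
  rw [h1, h2]
  -- What remains is the cancellation of `area a a'`: coefficient N²/Γ from the centre against N ·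
  -- (-N/Γ) from the satellites.
  field_simp
  ring

/-! ### The projection as a Poisson submersion -/

theorem proj_eq (hN : N ≠ 0) (z : Fin (N + 1) → ℂ) :
    proj N z = (‖relSum N z‖, unrot (relSum N z) • relW N z) := by
  refine Prod.ext rfl (Subtype.ext (funext fun n => ?_))
  rw [proj_snd_apply]
  simp only [Submodule.coe_smul, Pi.smul_apply, relW_apply _ _ hN, smul_eq_mul, unrot]
  by_cases h : relSum N z = 0
  · simp [h]
  · field_simp

theorem contDiff_relSum : ContDiff ℝ ∞ (relSum N) := by
  unfold relSum
  exact ContDiff.sum fun n _ => (contDiff_apply ℝ ℂ n.succ).sub (contDiff_apply ℝ ℂ 0)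

theorem contDiffOn_unrot : ContDiffOn ℝ ∞ unrot {s | s ≠ 0} := by
  refine ContDiffOn.mul ?_ ?_
  · exact Complex.ofRealCLM.contDiff.comp_contDiffOn (contDiffOn_id.norm ℝ fun s hs => hs)
  · exact contDiffOn_id.inv fun s hs => hs

theorem contDiffOn_proj (hN : N ≠ 0) (hΓ : Γ ≠ 0) : ContDiffOn ℝ ∞ (proj N) (Preg N Γ) := by
  have h : proj N = fun z => (‖relSum N z‖, unrot (relSum N z) • relW N z) := funext (proj_eq hN)
  have h0 : ∀ z ∈ Preg N Γ, relSum N z ≠ 0 := fun z hz => ((mem_Preg hN hΓ).1 hz).2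
  rw [h]
  refine (contDiff_relSum.contDiffOn.norm ℝ h0).prodMk ?_
  exact (contDiffOn_unrot.comp contDiff_relSum.contDiffOn h0).smul (relW N).contDiff.contDiffOn

theorem differentiableAt_proj (hN : N ≠ 0) (hΓ : Γ ≠ 0) {z : Fin (N + 1) → ℂ}
    (hz : z ∈ Preg N Γ) : DifferentiableAt ℝ (proj N) z :=
  ((contDiffOn_proj hN hΓ).contDiffAt ((isOpen_Preg hN hΓ).mem_nhds hz)).differentiableAt
    (by simp)

theorem relSum_add (z z' : Fin (N + 1) → ℂ) : relSum N (z + z') = relSum N z + relSum N z' := by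
  simp only [relSum, Pi.add_apply, ← Finset.sum_add_distrib]
  exact Finset.sum_congr rfl fun n _ => by ring

theorem relSum_csmul (c : ℂ) (z : Fin (N + 1) → ℂ) : relSum N (c • z) = c * relSum N z := by
  simp only [relSum, Pi.smul_apply, Finset.mul_sum, smul_eq_mul]
  exact Finset.sum_congr rfl fun n _ => by ring

theorem unrot_mul_self (s : ℂ) : unrot s * s = ‖s‖ := by
  by_cases h : s = 0
  · simp [h]
  · simp [unrot, h]

theorem norm_mul_ofReal {c : ℂ} (hc : ‖c‖ = 1) {r : ℝ} (hr : 0 < r) : ‖c * r‖ = r := by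
  rw [norm_mul, hc, Complex.norm_real, Real.norm_of_nonneg hr.le, one_mul]

theorem unrot_mul_ofReal {c : ℂ} (hc : ‖c‖ = 1) {r : ℝ} (hr : 0 < r) : unrot (c * r) = c⁻¹ := by
  have : (r : ℂ) ≠ 0 := by exact_mod_cast hr.ne'
  rw [unrot, norm_mul_ofReal hc hr, mul_inv, mul_left_comm, mul_inv_cancel₀ this, mul_one]

/-- Along this direction `relSum` keeps its argument for small t, so the rotation `unrot` is
constant and π is affine there. The gauge, turned back to the phase of z, is thus a right inverse of
the derivative of π. -/
theorem fderiv_proj_sect (hN : N ≠ 0) (hΓ : Γ ≠ 0) {z : Fin (N + 1) → ℂ} (hz : z ∈ Preg N Γ)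
    (u : ℝ × W N) : fderiv ℝ (proj N) z ((unrot (relSum N z))⁻¹ • sect N u) = u := by
  have hs : relSum N z ≠ 0 := ((mem_Preg hN hΓ).1 hz).2
  set A := unrot (relSum N z) with hA
  have hA1 : ‖A‖ = 1 := norm_unrot hs
  have hA0 : A ≠ 0 := norm_ne_zero_iff.1 (by rw [hA1]; exact one_ne_zero)
  refine hasFDerivAt_apply_eq_of_eventually (differentiableAt_proj hN hΓ hz).hasFDerivAt ?_
  have hc : ContinuousAt (fun t : ℝ => ‖relSum N z‖ + t * u.1) 0 := by fun_prop
  have hpos : (0 : ℝ) < ‖relSum N z‖ + 0 * u.1 := by simpa using norm_pos_iff.2 hs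
  filter_upwards [hc.eventually (lt_mem_nhds hpos)] with t ht
  have hS : relSum N (z + t • A⁻¹ • sect N u) = A⁻¹ * ((‖relSum N z‖ + t * u.1 : ℝ) : ℂ) := by
    rw [relSum_add, ← Complex.coe_smul, relSum_csmul, relSum_csmul, relSum_sect hN]
    push_cast
    rw [← unrot_mul_self, ← hA]
    field_simp
  have hA1' : ‖A⁻¹‖ = 1 := by rw [norm_inv, hA1, inv_one]
  rw [proj_eq hN, proj_eq hN, hS, norm_mul_ofReal hA1' ht, unrot_mul_ofReal hA1' ht, inv_inv, ← hA, map_add, ← Complex.coe_smul, relW_smul,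
    relW_smul, relW_sect hN]
  refine Prod.ext rfl ?_
  change A • (relW N z + (t : ℂ) • A⁻¹ • u.2) = A • relW N z + t • u.2
  rw [smul_add, smul_comm A, smul_inv_smul₀ hA0, coe_smul_W]

theorem surjective_fderiv_proj (hN : N ≠ 0) (hΓ : Γ ≠ 0) {z : Fin (N + 1) → ℂ}
    (hz : z ∈ Preg N Γ) : Function.Surjective (fderiv ℝ (proj N) z) :=
  fun u => ⟨_, fderiv_proj_sect hN hΓ hz u⟩

theorem fderiv_proj_const (hN : N ≠ 0) (hΓ : Γ ≠ 0) {z : Fin (N + 1) → ℂ} (hz : z ∈ Preg N Γ)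
    (v : ℂ) : fderiv ℝ (proj N) z (fun _ => v) = 0 := by
  refine hasFDerivAt_apply_eq_of_eventually (differentiableAt_proj hN hΓ hz).hasFDerivAt
    (.of_forall fun t => ?_)
  rw [smul_zero, add_zero, ← proj_smul ⟨1, t • v⟩ z]
  congr 1
  ext n
  simp

/-- Splits the displacement of one satellite into a part that fixes the satellites' mean and a
common shift of all satellites; the latter is the same for every n. -/
theorem single_succ_eq (n : Fin N) (v : ℂ) :
    (Pi.single n.succ v : Fin (N + 1) → ℂ) =
      sect N (0, projW N (Pi.single n v)) + Fin.cons 0 (fun _ => v / N) := by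
  ext m
  refine Fin.cases ?_ (fun m => ?_) m
  · simp
  · rcases eq_or_ne m n with rfl | h
    · simp [projW_apply]
    · simp [projW_apply, h]

theorem bracketP_comp_proj (hN : N ≠ 0) (hΓ : Γ ≠ 0) {f g : ℝ × W N → ℝ}
    (hf : ContDiffOn ℝ ∞ f (P1reg N)) (hg : ContDiffOn ℝ ∞ g (P1reg N)) {z : Fin (N + 1) → ℂ}
    (hz : z ∈ Preg N Γ) :
    bracketP N Γ (f ∘ proj N) (g ∘ proj N) z = bracketP1 N Γ f g (proj N z) := by
  have hu : proj N z ∈ P1reg N := image_proj_Preg hN hΓ ▸ Set.mem_image_of_mem _ hz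
  have hun := isOpen_P1reg.mem_nhds hu
  have hs : relSum N z ≠ 0 := ((mem_Preg hN hΓ).1 hz).2
  have hfd : HasFDerivAt f (fderiv ℝ f (proj N z)) (proj N z) :=
    ((hf.contDiffAt hun).differentiableAt (by simp)).hasFDerivAt
  have hgd : HasFDerivAt g (fderiv ℝ g (proj N z)) (proj N z) :=
    ((hg.contDiffAt hun).differentiableAt (by simp)).hasFDerivAt
  have hpd := (differentiableAt_proj hN hΓ hz).hasFDerivAt
  set A := unrot (relSum N z) with hA
  have hA1 : ‖A‖ = 1 := norm_unrot hs
  have hA0 : A ≠ 0 := norm_ne_zero_iff.1 (by rw [hA1]; exact one_ne_zero)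
  rw [bracketP1_eq hu.1 hfd.hasFDerivWithinAt hgd.hasFDerivWithinAt, bracketP, vortexBracket_eq,
    (hfd.comp z hpd).fderiv, (hgd.comp z hpd).fderiv]
  let c : ℂ →L[ℝ] (Fin (N + 1) → ℂ) := ContinuousLinearMap.pi
    (Fin.cons 0 fun _ => mulC (N : ℂ)⁻¹)
  have hc : ∀ v, c v = Fin.cons 0 (fun _ => v / N) := fun v => by
    ext m
    refine Fin.cases ?_ (fun m => ?_) m
    · simp [c]
    · simp [c, div_eq_inv_mul]
  have hsum : ∀ L : (ℝ × W N) →L[ℝ] ℝ, ∑ n, slot (L.comp (fderiv ℝ (proj N) z)) n = 0 :=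
    fun L => sum_slot_eq_zero fun v => by
      rw [ContinuousLinearMap.comp_apply, fderiv_proj_const hN hΓ hz, map_zero]
  -- This is the form a + bₙ required by `sum_area_strength`. The summand a comes from the common
  -- shift `c`, and bₙ is the relative part, rotated by `A`.
  have hsucc : ∀ (L : (ℝ × W N) →L[ℝ] ℝ) (n : Fin N),
      slot (L.comp (fderiv ℝ (proj N) z)) n.succ =
        L.comp ((fderiv ℝ (proj N) z).comp c) + (slotW L n).comp (mulC A) := by
    intro L n
    ext1 v
    simp only [slot_apply, add_apply, ContinuousLinearMap.comp_apply, slotW_apply,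
      mulC_apply, hc]
    rw [single_succ_eq, map_add, map_add, add_comm]
    congr 2
    have h := fderiv_proj_sect hN hΓ hz (0, projW N (Pi.single n (A * v)))
    rw [← h, ← hA]
    congr 1
    ext m
    have hm : (Pi.single n (A * v) : Fin N → ℂ) = A • Pi.single n v := by
      ext k
      rcases eq_or_ne k n with rfl | h <;> simp [*]
    refine Fin.cases ?_ (fun m => ?_) m
    · simp
    · simp [hm, projW_smul, hA0]
  have hsum' : ∀ L : (ℝ × W N) →L[ℝ] ℝ, ∑ n, (slotW L n).comp (mulC A) = 0 := fun L => by
    have h := sum_slotW hN L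
    ext1 v
    have h' := congrArg (fun M : ℂ →L[ℝ] ℝ => M (A * v)) h
    simpa using h'
  rw [sum_area_strength hN hΓ (hsum _) (hsum _) (hsucc _) (hsucc _) (hsum' _) (hsum' _)]
  simp only [area_comp_mulC, hA1, one_pow, one_mul]

/-! ### Quotient manifolds with one global chart -/

/-- `F` is a smooth submersion on the open set `U` whose fibres are the classes of `r`. -/
structure IsClassifyingMap {E : Type*} [NormedAddCommGroup E] [NormedSpace ℝ E] {U : Opens E}
    (r : Setoid U) {d : ℕ} (F : E → EuclideanSpace ℝ (Fin d)) : Prop where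
  contDiffOn : ContDiffOn ℝ ∞ F U
  surjective_fderiv : ∀ x ∈ U, Function.Surjective (fderiv ℝ F x)
  rel_iff : ∀ x y : U, r x y ↔ F x = F y

namespace IsClassifyingMap

variable {E : Type*} [NormedAddCommGroup E] [NormedSpace ℝ E] {U : Opens E}
  {r : Setoid U} {d : ℕ} {F : E → EuclideanSpace ℝ (Fin d)}

/-- The global chart of the quotient induced by a classifying map. -/
def chart (h : IsClassifyingMap r F) : Quotient r → EuclideanSpace ℝ (Fin d) :=
  Quotient.lift (fun x : U => F x) fun x y hxy => (h.rel_iff x y).1 hxy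

@[simp] theorem chart_mk (h : IsClassifyingMap r F) (x : U) : h.chart (Quotient.mk r x) = F x := rfl

theorem contDiffAt (h : IsClassifyingMap r F) (x : U) : ContDiffAt ℝ ∞ F x :=
  h.contDiffOn.contDiffAt (U.isOpen.mem_nhds x.2)

theorem isOpenMap [CompleteSpace E] (h : IsClassifyingMap r F) :
    IsOpenMap (fun x : U => F x) := by
  rw [isOpenMap_iff_nhds_le]
  intro x
  have h1 : HasStrictFDerivAt F (fderiv ℝ F x) x := (h.contDiffAt x).hasStrictFDerivAt (by simp)
  have h2 := h1.map_nhds_eq_of_surj (LinearMap.range_eq_top.2 (h.surjective_fderiv x x.2))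
  have h3 := U.isOpen.isOpenEmbedding_subtypeVal.map_nhds_eq x
  rw [show (fun x : U => F x) = F ∘ Subtype.val from rfl, ← Filter.map_map]
  exact (h3.symm ▸ h2).ge

/-- The classes are the fibres, which gives injectivity; a submersion is open. Being embedded in a
Euclidean space makes the quotient Hausdorff and second countable. -/
theorem isOpenEmbedding_chart [CompleteSpace E] (h : IsClassifyingMap r F) :
    IsOpenEmbedding h.chart := by
  refine .of_continuous_injective_isOpenMap ?_ ?_ ?_
  · refine Continuous.quotient_lift ?_ _
    exact (h.contDiffOn.continuousOn).comp_continuous continuous_subtype_val fun x => x.2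
  · rintro ⟨x⟩ ⟨y⟩ hxy
    exact Quotient.sound ((h.rel_iff x y).2 hxy)
  · intro V hV
    have : h.chart '' V = (fun x : U => F x) '' (Quotient.mk r ⁻¹' V) := by
      ext y
      constructor
      · rintro ⟨⟨x⟩, hx, rfl⟩
        exact ⟨x, hx, rfl⟩
      · rintro ⟨x, hx, rfl⟩
        exact ⟨_, hx, rfl⟩
    rw [this]
    exact h.isOpenMap _ (hV.preimage continuous_quotient_mk')

variable [CompleteSpace E] [Nonempty (Quotient r)]

/-- The smooth structure on the quotient given by the global chart. -/
@[reducible] def chartedSpace (h : IsClassifyingMap r F) :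
    ChartedSpace (EuclideanSpace ℝ (Fin d)) (Quotient r) :=
  h.isOpenEmbedding_chart.singletonChartedSpace

theorem contMDiff_mk (h : IsClassifyingMap r F) :
    letI := h.chartedSpace
    ContMDiff 𝓘(ℝ, E) (𝓡 d) ∞ (Quotient.mk r) := by
  let := h.chartedSpace
  have := h.isOpenEmbedding_chart.isManifold_singleton (I := 𝓡 d) (n := ∞)
  refine ContMDiff.of_comp_isOpenEmbedding h.isOpenEmbedding_chart ?_
  intro x
  exact contMDiffAt_subtype_iff.2 (h.contDiffAt x).contMDiffAt

theorem isQuotientManifold (h : IsClassifyingMap r F) :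
    letI := h.chartedSpace
    IsQuotientManifold E r d := by
  let := h.chartedSpace
  refine ⟨h.isOpenEmbedding_chart.isManifold_singleton, h.isOpenEmbedding_chart.isEmbedding.t2Space,
    h.isOpenEmbedding_chart.isEmbedding.secondCountableTopology, h.contMDiff_mk, fun x => ?_⟩
  have hd : MDifferentiableAt 𝓘(ℝ, E) (𝓡 d) (Quotient.mk r) x :=
    (h.contMDiff_mk x).mdifferentiableAt (by simp)
  -- Charts of the open set are restrictions of the identity and the chart of the quotient is
  -- induced by `F`, so the canonical map reads as `F` itself.
  have hw : writtenInExtChartAt 𝓘(ℝ, E) (𝓡 d) x (Quotient.mk r) =ᶠ[𝓝 (x : E)] F := by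
    filter_upwards [U.chartAt_subtype_val_symm_eventuallyEq (H := E) (x := x)] with y hy
    change F (((chartAt E x).symm y : U) : E) = F y
    congr 1
    exact hy.symm
  have key : ∀ v : E, (mfderiv 𝓘(ℝ, E) (𝓡 d) (Quotient.mk r) x v : EuclideanSpace ℝ (Fin d)) =
      fderiv ℝ F x v := by
    intro v
    refine (DFunLike.congr_fun hd.mfderiv v).trans ?_
    change fderivWithin ℝ (writtenInExtChartAt 𝓘(ℝ, E) (𝓡 d) x (Quotient.mk r))
      (Set.range (id : E → E)) (x : E) v = _
    rw [Set.range_id, fderivWithin_univ, hw.fderiv_eq]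
  intro v
  obtain ⟨y, hy⟩ := h.surjective_fderiv x x.2 v
  exact ⟨y, (key y).trans hy⟩

end IsClassifyingMap

section Diffeo

variable {E E' : Type*} [NormedAddCommGroup E] [NormedSpace ℝ E] [CompleteSpace E]
  [NormedAddCommGroup E'] [NormedSpace ℝ E'] [CompleteSpace E'] {U : Opens E} {U' : Opens E'}
  {r : Setoid U} {r' : Setoid U'} {d : ℕ} {F : E → EuclideanSpace ℝ (Fin d)}
  {F' : E' → EuclideanSpace ℝ (Fin d)} [Nonempty (Quotient r)] [Nonempty (Quotient r')]

/-- Two quotients whose global charts have the same image are diffeomorphic. -/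
theorem IsClassifyingMap.exists_diffeomorph (h : IsClassifyingMap r F)
    (h' : IsClassifyingMap r' F') (hr : Set.range h.chart = Set.range h'.chart) :
    letI := h.chartedSpace
    letI := h'.chartedSpace
    ∃ Φ : Diffeomorph (𝓡 d) (𝓡 d) (Quotient r) (Quotient r') ∞, ∀ q, h'.chart (Φ q) = h.chart q := by
  let := h.chartedSpace
  let := h'.chartedSpace
  have := h.isOpenEmbedding_chart.isManifold_singleton (I := 𝓡 d) (n := ∞)
  have := h'.isOpenEmbedding_chart.isManifold_singleton (I := 𝓡 d) (n := ∞)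
  let e : Quotient r ≃ Quotient r' :=
    ((Equiv.ofInjective _ h.isOpenEmbedding_chart.injective).trans (Equiv.setCongr hr)).trans
      (Equiv.ofInjective _ h'.isOpenEmbedding_chart.injective).symm
  have he : ∀ q, h'.chart (e q) = h.chart q := fun q =>
    Equiv.apply_ofInjective_symm h'.isOpenEmbedding_chart.injective _
  have he' : ∀ q, h.chart (e.symm q) = h'.chart q := fun q => by
    rw [← he, Equiv.apply_symm_apply]
  refine ⟨⟨e, ?_, ?_⟩, he⟩
  · refine ContMDiff.of_comp_isOpenEmbedding h'.isOpenEmbedding_chart ?_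
    rw [show h'.chart ∘ e = h.chart from funext he]
    exact contMDiff_isOpenEmbedding h.isOpenEmbedding_chart
  · refine ContMDiff.of_comp_isOpenEmbedding h.isOpenEmbedding_chart ?_
    rw [show h.chart ∘ e.symm = h'.chart from funext he']
    exact contMDiff_isOpenEmbedding h'.isOpenEmbedding_chart

end Diffeo

/-! ### The orbit spaces of the singular sectors -/

/-- The slice of `W` on which the coordinate `i` is real. -/
def slice (i : Fin N) : Submodule ℝ (W N) where
  carrier := {w | ((w : Fin N → ℂ) i).im = 0}
  zero_mem' := by simp
  add_mem' := fun {v w} hv hw => by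
    simp only [Set.mem_ofPred_eq] at hv hw ⊢
    simp [hv, hw]
  smul_mem' := fun c w hw => by
    simp only [Set.mem_ofPred_eq] at hw ⊢
    simp [hw]

theorem mem_slice {i : Fin N} {w : W N} : w ∈ slice i ↔ ((w : Fin N → ℂ) i).im = 0 := Iff.rfl

/-- A continuous linear extension to `W` of a linear chart of the slice. -/
theorem exists_sliceChart (i : Fin N) :
    ∃ (d : ℕ) (ρ : W N →L[ℝ] EuclideanSpace ℝ (Fin d)),
      Set.InjOn ρ (slice i) ∧ ∀ y, ∃ v ∈ slice i, ρ v = y := by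
  have hk : LinearMap.ker (slice i).subtype = ⊥ := Submodule.ker_subtype _
  -- A linear retraction of W onto the slice lets the chart be defined on all of W, so that it can
  -- be composed with `normalForm`.
  obtain ⟨l, hl⟩ := LinearMap.exists_leftInverse_of_injective (K := ℝ) (V := slice i)
    (V' := W N) (slice i).subtype hk
  have hl' : ∀ v : slice i, l v = v := fun v => LinearMap.congr_fun hl v
  let l' : W N →L[ℝ] slice i := ⟨l, LinearMap.continuous_of_finiteDimensional (𝕜 := ℝ)
    (E := W N) (F' := slice i) l⟩
  let e := toEuclidean (E := slice i)
  refine ⟨_, e.toContinuousLinearMap.comp l', ?_, fun y => ?_⟩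
  · intro v hv w hw h
    have := e.injective h
    simpa [l', hl' ⟨v, hv⟩, hl' ⟨w, hw⟩] using this
  · refine ⟨_, (e.symm y).2, ?_⟩
    simp [l', hl']

/-- The rotation-invariant map on `W` that rotates the coordinate `i` to the positive real axis. -/
def normalForm (i : Fin N) (w : W N) : W N := unrot ((w : Fin N → ℂ) i) • w

theorem normalForm_mem_slice (i : Fin N) (w : W N) : normalForm i w ∈ slice i := by
  rw [mem_slice, normalForm, Submodule.coe_smul, Pi.smul_apply, smul_eq_mul, unrot_mul_self,
    Complex.ofReal_im]

theorem coe_circle_smul (A : Circle) (w : W N) : A • w = (A : ℂ) • w := rfl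

theorem unrot_circle_mul (A : Circle) (s : ℂ) : unrot (A * s) * A = unrot s := by
  have hA : (A : ℂ) ≠ 0 := A.coe_ne_zero
  rw [unrot, unrot, norm_mul, Circle.norm_coe, one_mul, mul_inv]
  field_simp

theorem normalForm_eq_iff (i : Fin N) {v w : W N} (hv : (v : Fin N → ℂ) i ≠ 0)
    (hw : (w : Fin N → ℂ) i ≠ 0) :
    normalForm i v = normalForm i w ↔ ∃ A : Circle, A • w = v := by
  constructor
  · intro h
    have hv0 : unrot ((v : Fin N → ℂ) i) ≠ 0 :=
      norm_ne_zero_iff.1 (by rw [norm_unrot hv]; exact one_ne_zero)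
    have hm : (unrot ((v : Fin N → ℂ) i))⁻¹ * unrot ((w : Fin N → ℂ) i) ∈ Submonoid.unitSphere ℂ :=
      mem_sphere_zero_iff_norm.2 (by simp [norm_unrot hv, norm_unrot hw])
    refine ⟨⟨_, hm⟩, ?_⟩
    change ((unrot ((v : Fin N → ℂ) i))⁻¹ * unrot ((w : Fin N → ℂ) i)) • w = v
    rw [mul_smul]
    exact (inv_smul_eq_iff₀ hv0).2 h.symm
  · rintro ⟨A, rfl⟩
    rw [normalForm, normalForm, coe_circle_smul, smul_smul]
    congr 1
    exact unrot_circle_mul A _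

/-- Since v has real coordinate i, that coordinate of the moving point keeps its argument for small
t and the rotation stays constant. This supplies the surjectivity of the derivative on the slice. -/
theorem normalForm_add_smul (i : Fin N) {w v : W N} (hw : (w : Fin N → ℂ) i ≠ 0)
    (hv : v ∈ slice i) : ∀ᶠ t : ℝ in 𝓝 0,
      normalForm i (w + t • (unrot ((w : Fin N → ℂ) i))⁻¹ • v) = normalForm i w + t • v := by
  set s := (w : Fin N → ℂ) i with hs
  set A := unrot s with hA
  have hA1 : ‖A‖ = 1 := norm_unrot hw
  have hA0 : A ≠ 0 := norm_ne_zero_iff.1 (by rw [hA1]; exact one_ne_zero)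
  have hA1' : ‖A⁻¹‖ = 1 := by rw [norm_inv, hA1, inv_one]
  have hvr : (v : Fin N → ℂ) i = (((v : Fin N → ℂ) i).re : ℂ) :=
    Complex.ext rfl (by rw [Complex.ofReal_im]; exact hv)
  have hc : ContinuousAt (fun t : ℝ => ‖s‖ + t * ((v : Fin N → ℂ) i).re) 0 := by fun_prop
  have hpos : (0 : ℝ) < ‖s‖ + 0 * ((v : Fin N → ℂ) i).re := by simpa using norm_pos_iff.2 hw
  filter_upwards [hc.eventually (lt_mem_nhds hpos)] with t ht
  have hS : ((w + t • A⁻¹ • v : W N) : Fin N → ℂ) i =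
      A⁻¹ * ((‖s‖ + t * ((v : Fin N → ℂ) i).re : ℝ) : ℂ) := by
    rw [← coe_smul_W]
    simp only [Submodule.coe_add, Submodule.coe_smul, Pi.add_apply, Pi.smul_apply, smul_eq_mul,
      ← hs]
    push_cast
    rw [← unrot_mul_self, ← hA, ← hvr]
    field_simp
  rw [normalForm, hS, unrot_mul_ofReal hA1' ht, inv_inv, normalForm, ← hs, ← hA, smul_add,
    smul_comm A t, smul_inv_smul₀ hA0]

theorem contDiffOn_normalForm (i : Fin N) :
    ContDiffOn ℝ ∞ (normalForm i) {w | (w : Fin N → ℂ) i ≠ 0} := by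
  let l : W N →L[ℝ] ℂ := LinearMap.toContinuousLinearMap
    ((LinearMap.proj i).comp ((W N).subtype.restrictScalars ℝ))
  exact (contDiffOn_unrot.comp l.contDiff.contDiffOn fun w hw => hw).smul contDiffOn_id

theorem mem_P1singM {w : W N} : w ∈ P1singM N ↔ ((0 : ℝ), w) ∈ P1sing N := Iff.rfl

theorem coord_ne_zero_of_mem_P1singM (i : Fin N) {w : W N} (hw : w ∈ P1singM N) :
    (w : Fin N → ℂ) i ≠ 0 := by
  simpa using (mem_P1singM.1 hw).1.2.2 i

theorem isClassifyingMap_P1sing {d : ℕ} (i : Fin N)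
    {ρ : W N →L[ℝ] EuclideanSpace ℝ (Fin d)} (hρ : Set.InjOn ρ (slice i))
    (hρ' : ∀ y, ∃ v ∈ slice i, ρ v = y) :
    IsClassifyingMap (p1singSetoid N) (fun w => ρ (normalForm i w)) := by
  have hc : ContDiffOn ℝ ∞ (fun w => ρ (normalForm i w)) (P1singM N) :=
    ρ.contDiff.comp_contDiffOn
      ((contDiffOn_normalForm i).mono fun w hw => coord_ne_zero_of_mem_P1singM i hw)
  refine ⟨hc, fun w hw y => ?_, fun v w => ?_⟩
  · obtain ⟨v, hv, rfl⟩ := hρ' y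
    have hd := ((hc.contDiffAt ((P1singM N).isOpen.mem_nhds hw)).differentiableAt
      (by simp)).hasFDerivAt
    refine ⟨(unrot ((w : Fin N → ℂ) i))⁻¹ • v, hasFDerivAt_apply_eq_of_eventually hd ?_⟩
    filter_upwards [normalForm_add_smul i (coord_ne_zero_of_mem_P1singM i hw) hv] with t ht
    rw [ht, map_add, map_smul]
  · rw [hρ.eq_iff (normalForm_mem_slice i _) (normalForm_mem_slice i _),
      normalForm_eq_iff i (coord_ne_zero_of_mem_P1singM i v.2) (coord_ne_zero_of_mem_P1singM i w.2)]
    rfl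

/-! ### Transfer of the classification to `Psing` -/

theorem mem_PsingM {z : LinearMap.ker (nu N Γ)} :
    z ∈ PsingM N Γ ↔ (z : Fin (N + 1) → ℂ) ∈ Psing N Γ := Iff.rfl

theorem sect_relW_of_relSum_eq_zero (hN : N ≠ 0) {z : Fin (N + 1) → ℂ} (hz : relSum N z = 0) :
    sect N (0, relW N z) = (⟨1, -z 0⟩ : SE2) • z := by
  ext n
  refine Fin.cases ?_ (fun n => ?_) n
  · simp
  · rw [sect_succ, relW_apply _ _ hN, hz]
    simp [sub_eq_add_neg]

theorem relW_mem_P1singM (hN : N ≠ 0) (hΓ : Γ ≠ 0) {z : Fin (N + 1) → ℂ} (hz : z ∈ Psing N Γ) :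
    relW N z ∈ P1singM N := by
  have hz' := (mem_Psing hN hΓ).1 hz
  rw [mem_P1singM, mem_P1sing, sect_relW_of_relSum_eq_zero hN hz'.2, smul_mem_P]
  exact ⟨rfl, hz'.1⟩

theorem relW_SE2_smul (hN : N ≠ 0) (g : SE2) (z : Fin (N + 1) → ℂ) :
    relW N (g • z) = g.rot • relW N z := by
  ext n
  rw [relW_apply _ _ hN, relSum_smul, coe_circle_smul]
  change _ = (g.rot : ℂ) * (relW N z : Fin N → ℂ) n
  rw [relW_apply _ _ hN, SE2.smul_apply, SE2.smul_apply]
  ring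

/-- When ν = 0 the mean of the satellites is the central vortex, so `relW` loses nothing but the
translation; the rest of the group acts on it by rotations. -/
theorem exists_smul_eq_iff_relW (hN : N ≠ 0) {z z' : Fin (N + 1) → ℂ} (hz : relSum N z = 0)
    (hz' : relSum N z' = 0) :
    (∃ g : SE2, g • z' = z) ↔ ∃ A : Circle, A • relW N z' = relW N z := by
  constructor
  · rintro ⟨g, rfl⟩
    exact ⟨g.rot, (relW_SE2_smul hN g z').symm⟩
  · rintro ⟨A, hA⟩
    have h := sect_circle_smul A ((0 : ℝ), relW N z') rfl
    rw [hA, sect_relW_of_relSum_eq_zero hN hz, sect_relW_of_relSum_eq_zero hN hz'] at h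
    refine ⟨(⟨1, -z 0⟩ : SE2)⁻¹ * (SE2.ofCircle A * ⟨1, -z' 0⟩), ?_⟩
    rw [mul_smul, mul_smul, ← h, inv_smul_smul]

theorem sect_mem_ker_nu (hN : N ≠ 0) (hΓ : Γ ≠ 0) (w : W N) :
    sect N (0, w) ∈ LinearMap.ker (nu N Γ) := by
  rw [LinearMap.mem_ker, nu_eq_zero_iff hN hΓ, relSum_sect hN, Complex.ofReal_zero]

theorem relSum_eq_zero_of_ker (hN : N ≠ 0) (hΓ : Γ ≠ 0) (z : LinearMap.ker (nu N Γ)) :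
    relSum N (z : Fin (N + 1) → ℂ) = 0 := (nu_eq_zero_iff hN hΓ _).1 z.2

/-- The relative positions of the satellite vortices, on the linear subspace `ν = 0`. -/
def relWker (N : ℕ) (Γ : ℝ) : LinearMap.ker (nu N Γ) →L[ℝ] W N :=
  (relW N).comp (LinearMap.ker (nu N Γ)).subtypeL

theorem relWker_apply (z : LinearMap.ker (nu N Γ)) :
    relWker N Γ z = relW N (z : Fin (N + 1) → ℂ) := rfl

theorem isClassifyingMap_Psing (hN : N ≠ 0) (hΓ : Γ ≠ 0) {d : ℕ}
    {F : W N → EuclideanSpace ℝ (Fin d)} (hF : IsClassifyingMap (p1singSetoid N) F) :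
    IsClassifyingMap (psingSetoid N Γ) (fun z => F (relWker N Γ z)) := by
  have hm : ∀ z ∈ PsingM N Γ, relWker N Γ z ∈ P1singM N := fun z hz => relW_mem_P1singM hN hΓ hz
  refine ⟨hF.contDiffOn.comp (relWker N Γ).contDiff.contDiffOn hm, fun z hz y => ?_,
    fun z z' => ?_⟩
  · obtain ⟨v, hv⟩ := hF.surjective_fderiv _ (hm z hz) y
    have hd : HasFDerivAt F (fderiv ℝ F (relWker N Γ z)) (relWker N Γ z) :=
      ((hF.contDiffAt ⟨_, hm z hz⟩).differentiableAt (by simp)).hasFDerivAt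
    have hd' : fderiv ℝ (fun z => F (relWker N Γ z)) z = _ :=
      (hd.comp z (relWker N Γ).hasFDerivAt).fderiv
    refine ⟨⟨sect N (0, v), sect_mem_ker_nu hN hΓ v⟩, ?_⟩
    have hw : relWker N Γ ⟨sect N (0, v), sect_mem_ker_nu hN hΓ v⟩ = v := relW_sect hN (0, v)
    rw [hd', ContinuousLinearMap.comp_apply, hw, hv]
  · rw [← hF.rel_iff ⟨_, hm z z.2⟩ ⟨_, hm z' z'.2⟩]
    exact exists_smul_eq_iff_relW hN (relSum_eq_zero_of_ker hN hΓ _) (relSum_eq_zero_of_ker hN hΓ _)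

theorem exists_diffeomorph_orbitSpaces (hN : 2 ≤ N) (hΓ : Γ ≠ 0) :
    ∃ (d : ℕ) (_ : ChartedSpace (EuclideanSpace ℝ (Fin d)) (P1singQuot N))
        (_ : ChartedSpace (EuclideanSpace ℝ (Fin d)) (PsingQuot N Γ)),
      IsQuotientManifold (W N) (p1singSetoid N) d ∧
      IsQuotientManifold (LinearMap.ker (nu N Γ)) (psingSetoid N Γ) d ∧
      ∃ Φ : Diffeomorph (𝓡 d) (𝓡 d) (P1singQuot N) (PsingQuot N Γ) ∞,
        ∀ (u : P1singM N) (z : PsingM N Γ),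
          ((z : LinearMap.ker (nu N Γ)) : Fin (N + 1) → ℂ) = sect N (0, (u : W N)) →
          Φ (Quotient.mk (p1singSetoid N) u) = Quotient.mk (psingSetoid N Γ) z := by
  have hN' : N ≠ 0 := by omega
  obtain ⟨d, ρ, hρ, hρ'⟩ := exists_sliceChart (⟨0, by omega⟩ : Fin N)
  have h := isClassifyingMap_P1sing _ hρ hρ'
  have h' := isClassifyingMap_Psing hN' hΓ h
  obtain ⟨w₀, hw₀⟩ := exists_mem_P1sing hN
  have hs : ∀ w ∈ P1singM N,
      (⟨sect N (0, w), sect_mem_ker_nu hN' hΓ w⟩ : LinearMap.ker (nu N Γ)) ∈ PsingM N Γ :=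
    fun w hw => mapsTo_sect_P1sing hN' hΓ hw
  have : Nonempty (P1singQuot N) := ⟨Quotient.mk _ ⟨w₀, hw₀⟩⟩
  have : Nonempty (PsingQuot N Γ) := ⟨Quotient.mk _ ⟨_, hs w₀ hw₀⟩⟩
  -- The second chart is the first composed with `relW`, and `relW` undoes the gauge, so both take
  -- the same values.
  have hr : Set.range h.chart = Set.range h'.chart := by
    ext y
    constructor
    · rintro ⟨⟨w⟩, rfl⟩
      refine ⟨Quotient.mk _ ⟨_, hs w w.2⟩, ?_⟩
      rw [h'.chart_mk, relWker_apply, relW_sect hN']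
      rfl
    · rintro ⟨⟨z⟩, rfl⟩
      exact ⟨Quotient.mk _ ⟨_, relW_mem_P1singM hN' hΓ z.2⟩, rfl⟩
  obtain ⟨Φ, hΦ⟩ := h.exists_diffeomorph h' hr
  refine ⟨_, h.chartedSpace, h'.chartedSpace, h.isQuotientManifold, h'.isQuotientManifold, Φ, ?_⟩
  intro u z hz
  refine h'.isOpenEmbedding_chart.injective ?_
  rw [hΦ, h.chart_mk, h'.chart_mk, relWker_apply, hz, relW_sect hN']

/-! ### Extension of invariant functions from the singular sector -/

theorem exists_contDiffOn_extension {E : Type*} [NormedAddCommGroup E] [NormedSpace ℝ E]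
    {U : Opens E} {F : U → ℝ} (hF : ContMDiff 𝓘(ℝ, E) 𝓘(ℝ, ℝ) ∞ F) :
    ∃ G : E → ℝ, ContDiffOn ℝ ∞ G U ∧ ∀ x : U, G x = F x := by
  classical
  let G : E → ℝ := fun x => if h : x ∈ U then F ⟨x, h⟩ else 0
  have hG : ∀ x : U, G x = F x := fun x => dif_pos x.2
  refine ⟨G, fun x hx => ?_, hG⟩
  have h : ContMDiffAt 𝓘(ℝ, E) 𝓘(ℝ, ℝ) ∞ (fun y : U => G y) ⟨x, hx⟩ := by
    rw [show (fun y : U => G y) = F from funext hG]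
    exact hF _
  exact (contMDiffAt_subtype_iff.1 h).contDiffAt.contDiffWithinAt

theorem exists_invariant_extension (hN : N ≠ 0) (hΓ : Γ ≠ 0) {F : PsingM N Γ → ℝ}
    (hF : ContMDiff 𝓘(ℝ, LinearMap.ker (nu N Γ)) 𝓘(ℝ, ℝ) ∞ F)
    (hinv : ∀ z z' : PsingM N Γ, psingSetoid N Γ z z' → F z = F z') :
    ∃ U : Set (Fin (N + 1) → ℂ), IsInvariantOpen N U ∧ Psing N Γ ⊆ U ∧
      ∃ f : (Fin (N + 1) → ℂ) → ℝ, IsInvariantSmooth U f ∧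
        ∀ z : PsingM N Γ, f ((z : LinearMap.ker (nu N Γ)) : Fin (N + 1) → ℂ) = F z := by
  obtain ⟨G, hG, hGF⟩ := exists_contDiffOn_extension hF
  -- `κ` forgets the momentum and puts the central vortex at 0. It turns each group element into its
  -- rotation part and on `Psing` moves z only within its orbit, so composing with it extends
  -- invariant functions.
  let κ : (Fin (N + 1) → ℂ) →L[ℝ] LinearMap.ker (nu N Γ) :=
    ((sectL N).comp ((ContinuousLinearMap.inr ℝ ℝ (W N)).comp (relW N))).codRestrict _
      fun z => sect_mem_ker_nu hN hΓ (relW N z)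
  have hκ : ∀ z, (κ z : Fin (N + 1) → ℂ) = sect N (0, relW N z) := fun _ => rfl
  have hκg : ∀ (g : SE2) z, (κ (g • z) : Fin (N + 1) → ℂ) = SE2.ofCircle g.rot • (κ z).1 := by
    intro g z
    rw [hκ, hκ, relW_SE2_smul hN]
    exact sect_circle_smul g.rot ((0 : ℝ), relW N z) rfl
  have hsing : ∀ z ∈ Psing N Γ, ∃ g : SE2, (κ z : Fin (N + 1) → ℂ) = g • z := fun z hz =>
    ⟨_, sect_relW_of_relSum_eq_zero hN ((mem_Psing hN hΓ).1 hz).2⟩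
  have hU : ∀ (g : SE2) (z : Fin (N + 1) → ℂ), z ∈ P N ∩ κ ⁻¹' PsingM N Γ →
      g • z ∈ P N ∩ κ ⁻¹' PsingM N Γ := by
    rintro g z ⟨hz, hz'⟩
    refine ⟨(smul_mem_P g).2 hz, ?_⟩
    change (κ (g • z) : Fin (N + 1) → ℂ) ∈ Psing N Γ
    rw [hκg, smul_mem_Psing hN hΓ]
    exact hz'
  refine ⟨P N ∩ κ ⁻¹' PsingM N Γ, ⟨isOpen_P.inter ((PsingM N Γ).isOpen.preimage κ.continuous),
    Set.inter_subset_left, smul_set_eq_of_forall_mem hU⟩, fun z hz => ⟨hz.1, ?_⟩, G ∘ κ,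
    ⟨hG.comp κ.contDiff.contDiffOn fun z hz => hz.2, fun g z hz => ?_⟩, fun z => ?_⟩
  · obtain ⟨g, hg⟩ := hsing z hz
    change (κ z : Fin (N + 1) → ℂ) ∈ Psing N Γ
    rw [hg, smul_mem_Psing hN hΓ]
    exact hz
  · have h1 := hGF ⟨κ (g • z), (hU g z hz).2⟩
    have h2 := hGF ⟨κ z, hz.2⟩
    refine h1.trans ((hinv _ _ ?_).trans h2.symm)
    exact ⟨SE2.ofCircle g.rot, (hκg g z).symm⟩
  · obtain ⟨g, hg⟩ := hsing _ z.2
    have hm : κ ((z : LinearMap.ker (nu N Γ)) : Fin (N + 1) → ℂ) ∈ PsingM N Γ := by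
      rw [mem_PsingM, hg, smul_mem_Psing hN hΓ]
      exact z.2
    refine (hGF ⟨_, hm⟩).trans (hinv _ _ ?_)
    exact ⟨g, hg.symm⟩

/-! ### Integral curves -/

/-- The Hamiltonian vector field of the vortex system. -/
def fieldP (N : ℕ) (Γ : ℝ) : (Fin (N + 1) → ℂ) → Fin (N + 1) → ℂ :=
  hamField (strength N Γ) (HP N Γ)

theorem contDiffOn_fieldP : ContDiffOn ℝ ∞ (fieldP N Γ) (P N) :=
  contDiffOn_hamField _ isOpen_P contDiffOn_HP

theorem fderiv_HP_const {z : Fin (N + 1) → ℂ} (hz : z ∈ P N) (v : ℂ) :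
    fderiv ℝ (HP N Γ) z (fun _ => v) = 0 :=
  fderiv_const_eq_zero (differentiableAt_HP hz) (fun g => vortexHamiltonian_smul _ g z) v

theorem fieldP_translate (a : ℂ) {z : Fin (N + 1) → ℂ} (hz : z ∈ P N) :
    fieldP N Γ ((⟨1, a⟩ : SE2) • z) = fieldP N Γ z := by
  ext n
  have h := slot_fderiv_smul (g := ⟨1, a⟩) (z := z)
    (differentiableAt_HP (Γ := Γ) ((smul_mem_P _).2 hz))
    (.of_forall fun w => vortexHamiltonian_smul _ _ w) n
  rw [fieldP, hamField, hamField, h]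
  simp [hamVec]

/-- Conservation of momentum: ∑ Γₙ times the field is built from the sum of the slots of dH, which
vanishes by translation invariance. -/
theorem relSum_fieldP (hN : N ≠ 0) (hΓ : Γ ≠ 0) {z : Fin (N + 1) → ℂ} (hz : z ∈ P N) :
    relSum N (fieldP N Γ z) = 0 := by
  rw [← nu_eq_zero_iff hN hΓ, nu, LinearMap.sum_apply]
  simp only [LinearMap.smul_apply, LinearMap.proj_apply, smul_eq_mul, mul_assoc, ← Finset.mul_sum]
  have hs := sum_slot_eq_zero (fderiv_HP_const (Γ := Γ) hz)
  have h : ∀ n, (strength N Γ n : ℂ) * fieldP N Γ z n =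
      (slot (fderiv ℝ (HP N Γ) z) n Complex.I : ℂ) -
        (slot (fderiv ℝ (HP N Γ) z) n 1 : ℂ) * Complex.I := by
    intro n
    have hn : (strength N Γ n : ℂ) ≠ 0 := by exact_mod_cast strength_ne_zero hN hΓ n
    rw [fieldP, hamField, hamVec]
    push_cast
    field_simp
  simp only [h, Finset.sum_sub_distrib, ← Finset.sum_mul, ← Complex.ofReal_sum, ← sum_apply, hs]
  simp

/-- Identifies the reduced velocity, seen in the gauge, with the velocity relative to the central
vortex. -/
theorem sect_relW_fieldP (hN : N ≠ 0) (hΓ : Γ ≠ 0) {z : Fin (N + 1) → ℂ} (hz : z ∈ P N) :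
    sect N (0, relW N (fieldP N Γ z)) = fieldP N Γ z - fun _ => fieldP N Γ z 0 := by
  rw [sect_relW_of_relSum_eq_zero hN (relSum_fieldP hN hΓ hz)]
  ext n
  simp [sub_eq_add_neg]

theorem bracketP_HP_eq (f : (Fin (N + 1) → ℂ) → ℝ) (z : Fin (N + 1) → ℂ) :
    bracketP N Γ f (HP N Γ) z = fderiv ℝ f z (fieldP N Γ z) :=
  vortexBracket_eq_fderiv_hamField _ f _ z

/-- Exhibits the Hamiltonian vector field of P₁: u₀ is constant and the satellites follow the
relative part of the vortex field, also at the boundary. -/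
theorem bracketP1_HP1_eq (hN : N ≠ 0) {f : ℝ × W N → ℝ} {f' : (ℝ × W N) →L[ℝ] ℝ} {u : ℝ × W N}
    (hu : u ∈ P1 N) (hf : HasFDerivWithinAt f f' (P1 N) u) :
    bracketP1 N Γ f (HP1 N Γ) u = f' (0, relW N (fieldP N Γ (sect N u))) := by
  have hz := mapsTo_sect_P1 hu
  set L := fderiv ℝ (HP N Γ) (sect N u) with hL
  have hg : HasFDerivWithinAt (HP1 N Γ) (L.comp (sectL N)) (P1 N) u :=
    ((differentiableAt_HP hz).hasFDerivAt.comp u (sectL N).hasFDerivAt).hasFDerivWithinAt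
  have hslot : ∀ n, slotW (L.comp (sectL N)) n =
      slot L n.succ + (slot L 0).comp (mulC (N : ℂ)⁻¹) := by
    intro n
    ext1 v
    -- The two displacements differ by a constant vector, which dH annihilates. The leftover term at
    -- vortex 0 does not depend on n and pairs to zero with `slotW f'`, whose sum over n vanishes.
    have h : sect N (0, projW N (Pi.single n v)) + (fun _ => (N : ℂ)⁻¹ * v) =
        Pi.single n.succ v + Pi.single 0 ((N : ℂ)⁻¹ * v) := by
      rw [single_succ_eq]
      ext m
      refine Fin.cases ?_ (fun m => ?_) m
      · simp
      · simp [div_eq_inv_mul]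
    have h' := congrArg L h
    rw [map_add, map_add, fderiv_HP_const hz, add_zero] at h'
    exact h'
  have hsum : ∑ n, area (slotW f' n) ((slot L 0).comp (mulC (N : ℂ)⁻¹)) = 0 := by
    rw [sum_area_left, sum_slotW hN]
    simp [area]
  rw [bracketP1_eq hu hf hg]
  simp only [hslot, area_add_right, mul_add, Finset.sum_add_distrib, ← Finset.mul_sum, hsum]
  rw [mul_zero, add_zero, Finset.mul_sum]
  have h := apply_eq_sum_slot (f'.comp ((ContinuousLinearMap.inr ℝ ℝ (W N)).comp (projWL N)))
    (fun n => fieldP N Γ (sect N u) n.succ)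
  refine Eq.trans (Finset.sum_congr rfl fun n _ => ?_) h.symm
  rw [← apply_hamVec]
  rfl

/-- Integral curves are defined by testing with scalar functions; the real and imaginary parts of
the coordinates recover the derivative of the curve. -/
theorem hasDerivAt_comp_of_forall_dual {E : Type*} [NormedAddCommGroup E] [NormedSpace ℝ E]
    {k : ℕ} {c : ℝ → E} {v : E} {t : ℝ}
    (h : ∀ l : E →L[ℝ] ℝ, HasDerivAt (fun s => l (c s)) (l v) t) (T : E →L[ℝ] (Fin k → ℂ)) :
    HasDerivAt (fun s => T (c s)) (T v) t := by
  rw [hasDerivAt_pi]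
  intro n
  let p : E →L[ℝ] ℂ := (ContinuousLinearMap.proj (R := ℝ) (φ := fun _ : Fin k => ℂ) n).comp T
  have h1 : HasDerivAt (fun s => ((p (c s)).re : ℂ)) ((p v).re : ℂ) t :=
    (h (Complex.reCLM.comp p)).ofReal_comp
  have h2 : HasDerivAt (fun s => ((p (c s)).im : ℂ)) ((p v).im : ℂ) t :=
    (h (Complex.imCLM.comp p)).ofReal_comp
  have h3 := h1.add (h2.mul_const Complex.I)
  refine (h3.congr_deriv (Complex.re_add_im _)).congr_of_eventuallyEq (.of_forall fun s => ?_)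
  exact (Complex.re_add_im _).symm

/-- Solutions of an autonomous smooth differential equation are smooth. -/
theorem contDiffOn_of_hasDerivAt_autonomous {E : Type*} [NormedAddCommGroup E] [NormedSpace ℝ E]
    {U : Set E} {V : E → E} (hV : ContDiffOn ℝ ∞ V U) {I : Set ℝ} (hI : IsOpen I) {y : ℝ → E}
    (hy : ∀ t ∈ I, y t ∈ U) (hd : ∀ t ∈ I, HasDerivAt y (V (y t)) t) : ContDiffOn ℝ ∞ y I := by
  rw [contDiffOn_infty]
  intro n
  -- Bootstrap: if y is n times continuously differentiable, so is V ∘ y, which is the derivative of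
  -- y.
  induction n with
  | zero => exact contDiffOn_zero.2 fun t ht => (hd t ht).continuousAt.continuousWithinAt
  | succ n ih =>
    push_cast
    rw [contDiffOn_succ_iff_deriv_of_isOpen hI]
    refine ⟨fun t ht => (hd t ht).differentiableAt.differentiableWithinAt, by simp, ?_⟩
    exact ((hV.of_le (by exact_mod_cast le_top)).comp ih hy).congr fun t ht => (hd t ht).deriv

theorem exists_primitive_of_contDiffOn {h : ℝ → ℂ} {I : Set ℝ} (hI : IsOpen I)
    (hI' : I.OrdConnected) (hh : ContDiffOn ℝ ∞ h I) :
    ∃ a : ℝ → ℂ, ContDiffOn ℝ ∞ a I ∧ ∀ t ∈ I, HasDerivAt a (h t) t := by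
  rcases I.eq_empty_or_nonempty with rfl | ⟨t₀, ht₀⟩
  · exact ⟨0, by simp, by simp⟩
  have hd : ∀ t ∈ I, HasDerivAt (fun t => ∫ s in t₀..t, h s) (h t) t := fun t ht =>
    intervalIntegral.integral_hasDerivAt_right
      ((hh.continuousOn.mono (hI'.uIcc_subset ht₀ ht)).intervalIntegrable)
      (hh.continuousOn.stronglyMeasurableAtFilter hI t ht)
      (hh.continuousOn.continuousAt (hI.mem_nhds ht))
  refine ⟨_, ?_, hd⟩
  rw [contDiffOn_infty_iff_deriv_of_isOpen hI]
  exact ⟨fun t ht => (hd t ht).differentiableAt.differentiableWithinAt,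
    hh.congr fun t ht => (hd t ht).deriv⟩

theorem isIntegralCurve_P_iff {I : Set ℝ} {d : ℝ → Fin (N + 1) → ℂ} :
    IsIntegralCurveOfHamiltonian (P N) (bracketP N Γ) (HP N Γ) I d ↔
      ∀ t ∈ I, d t ∈ P N ∧ HasDerivAt d (fieldP N Γ (d t)) t := by
  refine forall₂_congr fun t _ => and_congr_right fun hP => ⟨fun h => ?_, fun h f hf => ?_⟩
  · refine hasDerivAt_comp_of_forall_dual (fun l => ?_) (ContinuousLinearMap.id ℝ _)
    have := h l l.contDiff.contDiffOn
    rwa [bracketP_HP_eq, l.fderiv] at this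
  · rw [bracketP_HP_eq]
    exact ((hf.contDiffAt (isOpen_P.mem_nhds hP)).differentiableAt
      (by simp)).hasFDerivAt.comp_hasDerivAt t h

/-- In the gauge the equation lacks the velocity of the central vortex. Its primitive a(t) restores
it as a translation, and the vortex field is unchanged under translations. -/
theorem exists_lift_integralCurve (hN : N ≠ 0) (hΓ : Γ ≠ 0) {I : Set ℝ} (hI : IsOpen I)
    (hI' : I.OrdConnected) {c : ℝ → ℝ × W N}
    (hc : IsIntegralCurveOfHamiltonian (P1 N) (bracketP1 N Γ) (HP1 N Γ) I c)
    (hs : ∀ t ∈ I, c t ∈ P1sing N) :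
    ∃ g : ℝ → SE2, SmoothCurve I g ∧
      IsIntegralCurveOfHamiltonian (P N) (bracketP N Γ) (HP N Γ) I (fun t => g t • sect N (c t)) ∧
      ∀ t ∈ I, g t • sect N (c t) ∈ Psing N Γ := by
  have hP : ∀ t ∈ I, sect N (c t) ∈ P N := fun t ht => mapsTo_sect_P1 (hc t ht).1
  have hd : ∀ t ∈ I, HasDerivAt (fun s => sect N (c s))
      (fieldP N Γ (sect N (c t)) - fun _ => fieldP N Γ (sect N (c t)) 0) t := by
    intro t ht
    rw [← sect_relW_fieldP hN hΓ (hP t ht)]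
    refine hasDerivAt_comp_of_forall_dual (fun l => ?_) (sectL N)
    have h := (hc t ht).2 l l.contDiff.contDiffOn
    rwa [bracketP1_HP1_eq hN (hc t ht).1 l.hasFDerivWithinAt] at h
  have hV : ContDiffOn ℝ ∞ (fun z => fieldP N Γ z - fun _ => fieldP N Γ z 0) (P N) := by
    refine contDiffOn_fieldP.sub (contDiffOn_pi.2 fun _ => ?_)
    exact (contDiffOn_pi.1 contDiffOn_fieldP) 0
  have hy := contDiffOn_of_hasDerivAt_autonomous hV hI hP hd
  obtain ⟨a, ha, had⟩ := exists_primitive_of_contDiffOn hI hI'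
    (((contDiffOn_pi.1 (contDiffOn_fieldP (N := N) (Γ := Γ))) 0).comp hy hP)
  refine ⟨fun t => ⟨1, a t⟩, contDiffOn_const.prodMk ha, isIntegralCurve_P_iff.2 fun t ht =>
    ⟨(smul_mem_P _).2 (hP t ht), ?_⟩, fun t ht => ?_⟩
  · rw [fieldP_translate _ (hP t ht)]
    have h := (hd t ht).add (hasDerivAt_pi.2 fun _ : Fin (N + 1) => had t ht)
    refine (h.congr_deriv ?_).congr_of_eventuallyEq (.of_forall fun s => ?_)
    · exact sub_add_cancel _ _
    · ext n
      simp
  · rw [smul_mem_Psing hN hΓ]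
    exact mapsTo_sect_P1sing hN hΓ (hs t ht)

/-- The reduced curve is the satellite configuration relative to z₀, and g is the translation by
z₀(t). -/
theorem exists_reduction_integralCurve (hN : N ≠ 0) (hΓ : Γ ≠ 0) {I : Set ℝ} (hI : IsOpen I)
    {d : ℝ → Fin (N + 1) → ℂ}
    (hd : IsIntegralCurveOfHamiltonian (P N) (bracketP N Γ) (HP N Γ) I d)
    (hs : ∀ t ∈ I, d t ∈ Psing N Γ) :
    ∃ c : ℝ → ℝ × W N, ∃ g : ℝ → SE2,
      IsIntegralCurveOfHamiltonian (P1 N) (bracketP1 N Γ) (HP1 N Γ) I c ∧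
      (∀ t ∈ I, c t ∈ P1sing N) ∧ SmoothCurve I g ∧ ∀ t ∈ I, d t = g t • sect N (c t) := by
  rw [isIntegralCurve_P_iff] at hd
  have hc : ∀ t ∈ I, ((0 : ℝ), relW N (d t)) ∈ P1sing N := fun t ht =>
    relW_mem_P1singM hN hΓ (hs t ht)
  have hsect : ∀ t ∈ I, sect N (0, relW N (d t)) = (⟨1, -d t 0⟩ : SE2) • d t := fun t ht =>
    sect_relW_of_relSum_eq_zero hN ((mem_Psing hN hΓ).1 (hs t ht)).2
  refine ⟨fun t => (0, relW N (d t)), fun t => ⟨1, d t 0⟩, fun t ht => ⟨(hc t ht).1, fun f hf => ?_⟩,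
    hc, ?_, fun t ht => ?_⟩
  · have hf' := (hf.differentiableOn (by simp) _ (hc t ht).1).hasFDerivWithinAt
    rw [bracketP1_HP1_eq hN (hc t ht).1 hf', hsect t ht, fieldP_translate _ (hd t ht).1]
    have hcd : HasDerivAt (fun s => ((0 : ℝ), relW N (d s))) (0, relW N (fieldP N Γ (d t))) t :=
      (hasDerivAt_const t (0 : ℝ)).prodMk ((relW N).hasFDerivAt.comp_hasDerivAt t (hd t ht).2)
    -- The derivative of f within P₁ suffices because the curve stays in P₁ near t.
    exact HasFDerivWithinAt.comp_hasDerivAt t hf' hcd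
      (Filter.mem_of_superset (hI.mem_nhds ht) fun s hs' => (hc s hs').1)
  · have h := contDiffOn_of_hasDerivAt_autonomous contDiffOn_fieldP hI (fun t ht => (hd t ht).1)
      fun t ht => (hd t ht).2
    exact contDiffOn_const.prodMk ((contDiffOn_pi.1 h) 0)
  · rw [hsect t ht]
    ext n
    simp

end VortexResolution

end


open VortexResolution in
theorem mainTheorem1 (N : ℕ) (hN : 2 ≤ N) (Γ : ℝ) (hΓ : Γ ≠ 0) :
    -- decomposition of the phase space into invariant submanifolds
    (Preg N Γ ∪ Psing N Γ = P N ∧ Disjoint (Preg N Γ) (Psing N Γ) ∧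
      (∀ g : SE2, g • Preg N Γ = Preg N Γ) ∧ (∀ g : SE2, g • Psing N Γ = Psing N Γ) ∧
      IsOpen (P N) ∧ IsOpen (Preg N Γ) ∧ P N ⊆ closure (Preg N Γ) ∧
      Function.Surjective (nu N Γ)) ∧
    -- the regular sector is a Poisson submanifold
    (∀ U : Set (Fin (N + 1) → ℂ), IsOpen U → U ⊆ P N → ∀ f g : (Fin (N + 1) → ℂ) → ℝ,
      ContDiffOn ℝ ∞ f U → ContDiffOn ℝ ∞ g U → (∀ z ∈ U ∩ Preg N Γ, g z = 0) →
      ∀ z ∈ U ∩ Preg N Γ, bracketP N Γ f g z = 0) ∧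
    -- the singular sector is Poisson for invariant functions: `P^sing / SE(2)` has a Poisson
    -- bracket, by extension of functions from `P^sing / SE(2)` to `P / SE(2)`
    (∀ U : Set (Fin (N + 1) → ℂ), IsInvariantOpen N U → ∀ f g : (Fin (N + 1) → ℂ) → ℝ,
      IsInvariantSmooth U f → IsInvariantSmooth U g → IsInvariantSmooth U (bracketP N Γ f g)) ∧
    (∀ U : Set (Fin (N + 1) → ℂ), IsInvariantOpen N U → ∀ f g : (Fin (N + 1) → ℂ) → ℝ,
      IsInvariantSmooth U f → ContDiffOn ℝ ∞ g U → (∀ z ∈ U ∩ Psing N Γ, g z = 0) →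
      ∀ z ∈ U ∩ Psing N Γ, bracketP N Γ f g z = 0) ∧
    (∀ F : PsingM N Γ → ℝ, ContMDiff 𝓘(ℝ, LinearMap.ker (nu N Γ)) 𝓘(ℝ, ℝ) ∞ F →
      (∀ z z' : PsingM N Γ, psingSetoid N Γ z z' → F z = F z') →
      ∃ U : Set (Fin (N + 1) → ℂ), IsInvariantOpen N U ∧ Psing N Γ ⊆ U ∧
        ∃ f : (Fin (N + 1) → ℂ) → ℝ, IsInvariantSmooth U f ∧
          ∀ z : PsingM N Γ, f ((z : LinearMap.ker (nu N Γ)) : Fin (N + 1) → ℂ) = F z) ∧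
    -- decomposition of the unified phase space
    (P1reg N ∪ P1sing N = P1 N ∧ Disjoint (P1reg N) (P1sing N)) ∧
    -- `π` is a Poisson quotient for the action of `SE(2)` on the regular sector
    (proj N '' Preg N Γ = P1reg N ∧
      ContDiffOn ℝ ∞ (proj N) (Preg N Γ) ∧
      (∀ z ∈ Preg N Γ, Function.Surjective (fderiv ℝ (proj N) z)) ∧
      (∀ f g : ℝ × W N → ℝ, ContDiffOn ℝ ∞ f (P1reg N) → ContDiffOn ℝ ∞ g (P1reg N) →
        ∀ z ∈ Preg N Γ,
          bracketP N Γ (f ∘ proj N) (g ∘ proj N) z = bracketP1 N Γ f g (proj N z)) ∧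
      (∀ z ∈ Preg N Γ, ∀ z' ∈ Preg N Γ, proj N z = proj N z' ↔ ∃ g : SE2, g • z = z')) ∧
    -- the Hamiltonian descends, and Hamiltonian and bracket are smooth up to the boundary
    ((∀ z ∈ Preg N Γ, HP1 N Γ (proj N z) = HP N Γ z) ∧
      ContDiffOn ℝ ∞ (HP1 N Γ) (P1 N) ∧
      (∀ f g : ℝ × W N → ℝ, ContDiffOn ℝ ∞ f (P1 N) → ContDiffOn ℝ ∞ g (P1 N) →
        ContDiffOn ℝ ∞ (bracketP1 N Γ f g) (P1 N))) ∧
    -- `ι` is an injective immersion that respects the decompositions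
    (Set.MapsTo (sect N) (P1 N) (P N) ∧ Set.InjOn (sect N) (P1 N) ∧
      ContDiffOn ℝ ∞ (sect N) (P1 N) ∧
      (∀ u ∈ P1 N, Function.Injective (fderivWithin ℝ (sect N) (P1 N) u)) ∧
      Set.MapsTo (sect N) (P1reg N) (Preg N Γ) ∧
      Set.MapsTo (sect N) (P1sing N) (Psing N Γ)) ∧
    -- the stabilizer of the singular sector in the standard gauge is `SO(2)`, and `ι` intertwines
    MulAction.stabilizer SE2 (sect N '' P1sing N) = SO2 ∧
    (∀ A : Circle, ∀ u ∈ P1sing N, (u.1, A • u.2) ∈ P1sing N ∧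
      sect N (u.1, A • u.2) = SE2.ofCircle A • sect N u) ∧
    -- `ι` induces a diffeomorphism of the orbit spaces of the singular sectors
    (∃ (d : ℕ) (_ : ChartedSpace (EuclideanSpace ℝ (Fin d)) (P1singQuot N))
        (_ : ChartedSpace (EuclideanSpace ℝ (Fin d)) (PsingQuot N Γ)),
      IsQuotientManifold (W N) (p1singSetoid N) d ∧
      IsQuotientManifold (LinearMap.ker (nu N Γ)) (psingSetoid N Γ) d ∧
      ∃ Φ : Diffeomorph (𝓡 d) (𝓡 d) (P1singQuot N) (PsingQuot N Γ) ∞,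
        ∀ (u : P1singM N) (z : PsingM N Γ),
          ((z : LinearMap.ker (nu N Γ)) : Fin (N + 1) → ℂ) = sect N (0, (u : W N)) →
          Φ (Quotient.mk (p1singSetoid N) u) = Quotient.mk (psingSetoid N Γ) z) ∧
    -- integral curves on the boundary and in the singular sector
    (∀ I : Set ℝ, IsOpen I → I.OrdConnected →
      (∀ c : ℝ → ℝ × W N,
        IsIntegralCurveOfHamiltonian (P1 N) (bracketP1 N Γ) (HP1 N Γ) I c →
        (∀ t ∈ I, c t ∈ P1sing N) →
        ∃ g : ℝ → SE2, SmoothCurve I g ∧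
          IsIntegralCurveOfHamiltonian (P N) (bracketP N Γ) (HP N Γ) I
            (fun t => g t • sect N (c t)) ∧
          ∀ t ∈ I, g t • sect N (c t) ∈ Psing N Γ) ∧
      (∀ d : ℝ → Fin (N + 1) → ℂ,
        IsIntegralCurveOfHamiltonian (P N) (bracketP N Γ) (HP N Γ) I d →
        (∀ t ∈ I, d t ∈ Psing N Γ) →
        ∃ c : ℝ → ℝ × W N, ∃ g : ℝ → SE2,
          IsIntegralCurveOfHamiltonian (P1 N) (bracketP1 N Γ) (HP1 N Γ) I c ∧
          (∀ t ∈ I, c t ∈ P1sing N) ∧ SmoothCurve I g ∧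
          ∀ t ∈ I, d t = g t • sect N (c t))) := by
  have hN' : N ≠ 0 := by omega
  refine ⟨⟨Preg_union_Psing, disjoint_Preg_Psing,
      smul_set_eq_of_forall_mem fun g _ => (smul_mem_Preg hN' hΓ g).2,
      smul_set_eq_of_forall_mem fun g _ => (smul_mem_Psing hN' hΓ g).2, isOpen_P,
      isOpen_Preg hN' hΓ, P_subset_closure_Preg hN' hΓ, surjective_nu hΓ⟩,
    fun U hU _ f g _ _ h0 z hz =>
      vortexBracket_eq_zero_of_eqOn _ (hU.inter (isOpen_Preg hN' hΓ)) h0 hz,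
    fun U hU f g => isInvariantSmooth_bracketP hU,
    fun U hU f g hf hg h0 z hz => bracketP_eq_zero_of_eqOn_Psing hN' hΓ hU hf hg h0 hz,
    fun F => exists_invariant_extension hN' hΓ,
    ⟨P1reg_union_P1sing, disjoint_P1reg_P1sing⟩,
    ⟨image_proj_Preg hN' hΓ, contDiffOn_proj hN' hΓ, fun z => surjective_fderiv_proj hN' hΓ,
      fun f g hf hg z => bracketP_comp_proj hN' hΓ hf hg,
      fun z hz z' hz' => proj_eq_proj_iff hN' hΓ hz hz'⟩,
    ⟨fun z => HP1_proj hN' hΓ, contDiffOn_HP1, fun f g => contDiffOn_bracketP1⟩,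
    ⟨mapsTo_sect_P1, (injective_sect hN').injOn, contDiff_sect.contDiffOn,
      fun u => injective_fderivWithin_sect hN', mapsTo_sect_P1reg hN' hΓ,
      mapsTo_sect_P1sing hN' hΓ⟩,
    stabilizer_sect_P1sing hN,
    fun A u hu => ⟨circle_smul_mem_P1sing A hu, sect_circle_smul A u (mem_P1sing.1 hu).1⟩,
    exists_diffeomorph_orbitSpaces hN hΓ,
    fun I hI hI' => ⟨fun c => exists_lift_integralCurve hN' hΓ hI hI',
      fun d => exists_reduction_integralCurve hN' hΓ hI⟩⟩
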